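/- Let $V=\bigoplus_{\Delta\ge 0}V_\Delta$ be a chiral vertex operator algebra over $\mathbb C$: $\dim V_0=1$, $\dim V_\Delta<\infty$, with nonzero vacuum $|0\rangle\in V_0$, nonzero Virasoro vector $T\in V_2$, and modes $J_n(v)\in\operatorname{End}V$, linear in $v\in V$, $n\in\mathbb Z$, with $J_n(v)V_d\subseteq V_{d-n}$, such that: $J_n(|0\rangle)=\delta_{n,0}\operatorname{id}$; for $v\in V_\Delta$, $J_{-\Delta}(v)|0\rangle=v$ and $J_n(v)|0\rangle=0$ for $n>-\Delta$; the $T(n)=J_n(T)$ satisfy the Virasoro relations with some central charge; $T(0)=\Delta$ on $V_\Delta$; $J_n(T(-1)v)=-(n+\Delta)J_n(v)$ for $v\in V_\Delta$; and, for $v_i\in V_{\Delta_i}$, the commutator formula $$[J_m(v_1),J_n(v_2)]=\sum_{j=0}^{\Delta_1+\Delta_2-1}\binom{m+\Delta_1-1}{j}J_{m+n}(J_{j-\Delta_1+1}(v_1)v_2)$$ and the associativity formula $$J_m(J_n(v_1)v_2)=\sum_{j\ge0}(-1)^j\binom{n+\Delta_1-1}{j}\Big(J_{n-j}(v_1)J_{m-n+j}(v_2)-(-1)^{n+\Delta_1-1}J_{m+\Delta_1-j-1}(v_2)J_{j-\Delta_1+1}(v_1)\Big).$$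 Let $C_2(V)$ be the span of all $J_{-\Delta-p}(v)u$ with $v\in V_\Delta$, $u\in V$, $p\ge1$. *Current algebra.* Let $\mathfrak g(V)$ be the quotient of $V\otimes\mathbb C((\xi))$ by the image of $T(-1)\otimes 1+1\otimes\frac{d}{d\xi}$, write $J(v,f)$ for the class of $v\otimes f$ and $J_n(v)=J(v,\xi^{n+\Delta-1})$ for $v\in V_\Delta$; it is a Lie algebra with $$[J(v_1,f_1),J(v_2,f_2)]=\sum_{m=0}^{\Delta_1+\Delta_2-1}\tfrac1{m!}J\big(J_{m-\Delta_1+1}(v_1)v_2,\,f_1^{(m)}f_2\big)\qquad(v_i\in V_{\Delta_i}).$$ Let $F^p\mathfrak g(V)$ be the span of the $J(v,f)$ with $v\in V_\Delta$, $f\in\xi^{p+\Delta-1}\mathbb C[[\xi]]$, and $G_p\mathfrak g(V)$ the span of the $J(v,f)$ with $v\in V_\Delta$, $\Delta\le p$. On the universal enveloping algebra $A=U(\mathfrak g(V))$ put $F^pA=\sum_{p_1+\dots+p_r\ge p}F^{p_1}\mathfrak g(V)\cdots F^{p_r}\mathfrak g(V)$, $G_pA=\sum_{p_1+\dots+p_r\le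 p}G_{p_1}\mathfrak g(V)\cdots G_{p_r}\mathfrak g(V)$ and $F^p_NA=F^pA\cap A\cdot F^NA$. Let $F^p\widehat A=\varprojlim_N F^pA/F^p_NA$, let $F^p_N\widehat A$ be the closure of $F^p_NA$ in it, let $\widehat A=\bigcup_pF^p\widehat A$, and let $G_p\widehat A$ be the union over $q$ of the closures of $G_pA\cap F^qA$ in $F^q\widehat A$. The current algebra $\mathcal U(V)$ is the quotient of $\widehat A$ by the two-sided ideal generated by $J_0(|0\rangle)-1$ and the associativity relations (as convergent infinite sums in $\widehat A$); $F^p\,\mathcal U(V)$, $F^p_N\,\mathcal U(V)$ and $G_p\,\mathcal U(V)$ are the images of $F^p\widehat A$, $F^p_N\widehat A$ and $G_p\widehat A$. *Modules.* A $V$-module is a finitely generated $\mathcal U(V)$-module $M$ such that $F^0\mathcal U(V)m$ is finite dimensional for every $m\in M$, and on which $\mathcal U(V)$ acts continuously for the discrete topology of $M$: for all $m\in M$ and $p\in\mathbb Z$ there is $N$ with $F^p_N\,\mathcal U(V)\,m=0$. *Theorem.* Let $M$ be a $V$-module and let $W\subseteq M$ be a finite dimensional $F^0\mathcal U(V)$-submodule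 that generates $M$ over $\mathcal U(V)$. Give $M$ the good filtration $G_pM=G_p\,\mathcal U(V)W$ for $p\ge0$, $G_pM=0$ for $p<0$, and put $\operatorname{gr}^G_pM=G_pM/G_{p-1}M$. Let $U\subseteq V$ be a graded subspace with $V=U\oplus C_2(V)\oplus\mathbb C|0\rangle$. Then for every integer $p\ge0$ the space $\operatorname{gr}^G_pM$ is linearly spanned by the classes of the vectors $$J_{-n_1}(v_1)\cdots J_{-n_r}(v_r)w,\qquad r\ge0,\ w\in W,\ n_1>n_2>\dots>n_r>0,$$ where $v_1,\dots,v_r\in U$ are homogeneous and $\sum_{i=1}^r|v_i|=p$ (with $v_i\in V_{|v_i|}$). -/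

import Mathlib

open scoped TensorProduct

noncomputable section

universe u v

/-- A chiral vertex operator algebra structure on the complex vector space `V`. The grading
`V = ⨁_{Δ ≥ 0} V_Δ` is indexed by `ℤ`, with `V_Δ = 0` for `Δ < 0`. -/
structure ChiralVOA (V : Type u) [AddCommGroup V] [Module ℂ V] where
  /-- the weight space `V_Δ` -/
  wt : ℤ → Submodule ℂ V
  wt_neg : ∀ Δ < 0, wt Δ = ⊥
  decomposition : DirectSum.IsInternal wt
  finrank_wt_zero : Module.finrank ℂ (wt 0) = 1
  finite_wt : ∀ Δ, FiniteDimensional ℂ (wt Δ)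
  /-- the vacuum vector -/
  vac : V
  vac_mem : vac ∈ wt 0
  vac_ne_zero : vac ≠ 0
  /-- the Virasoro vector -/
  T : V
  T_mem : T ∈ wt 2
  T_ne_zero : T ≠ 0
  /-- the modes `J_n(v)` -/
  J : ℤ → V →ₗ[ℂ] Module.End ℂ V
  J_mem : ∀ (n : ℤ) (v : V) (d : ℤ), ∀ x ∈ wt d, J n v x ∈ wt (d - n)
  J_zero_vac : J 0 vac = 1
  J_vac : ∀ n : ℤ, n ≠ 0 → J n vac = 0
  J_apply_vac : ∀ (Δ : ℤ), ∀ v ∈ wt Δ, J (-Δ) v vac = v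
  J_apply_vac_of_lt : ∀ (Δ : ℤ), ∀ v ∈ wt Δ, ∀ n : ℤ, -Δ < n → J n v vac = 0
  /-- the central charge -/
  c : ℂ
  virasoro : ∀ m n : ℤ, J m T * J n T - J n T * J m T =
    ((m - n : ℤ) : ℂ) • J (m + n) T +
      (if m + n = 0 then (((m : ℂ) ^ 3 - m) / 12 * c) • (1 : Module.End ℂ V) else 0)
  T_zero_apply : ∀ (Δ : ℤ), ∀ v ∈ wt Δ, J 0 T v = (Δ : ℂ) • v
  translation : ∀ (Δ : ℤ), ∀ v ∈ wt Δ, ∀ n : ℤ, J n (J (-1) T v) = (-((n + Δ : ℤ) : ℂ)) • J n v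
  commutator : ∀ (Δ₁ Δ₂ : ℤ), ∀ v₁ ∈ wt Δ₁, ∀ v₂ ∈ wt Δ₂, ∀ m n : ℤ,
    J m v₁ * J n v₂ - J n v₂ * J m v₁ =
      ∑ j ∈ Finset.range (Δ₁ + Δ₂).toNat,
        ((Ring.choose (m + Δ₁ - 1) j : ℤ) : ℂ) • J (m + n) (J (j - Δ₁ + 1) v₁ v₂)
  /-- The sum is finite on every vector `x`, because `J` shifts weights and weights are bounded
  below. -/
  associativity : ∀ (Δ₁ Δ₂ : ℤ), ∀ v₁ ∈ wt Δ₁, ∀ v₂ ∈ wt Δ₂, ∀ (m n : ℤ) (x : V),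
    J m (J n v₁ v₂) x =
      ∑ᶠ j : ℕ, ((-1 : ℂ) ^ j * ((Ring.choose (n + Δ₁ - 1) j : ℤ) : ℂ)) •
        (J (n - j) v₁ (J (m - n + j) v₂ x)
          - (-1 : ℂ) ^ (n + Δ₁ - 1) • J (m + Δ₁ - j - 1) v₂ (J (j - Δ₁ + 1) v₁ x))

namespace ChiralVOA

variable {V : Type u} [AddCommGroup V] [Module ℂ V] (𝒱 : ChiralVOA V)

/-- `C₂(V)`, spanned by the vectors `J_{-Δ-p}(v)u` with `v ∈ V_Δ`, `u ∈ V` and `p ≥ 1`. -/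
def C2 : Submodule ℂ V :=
  Submodule.span ℂ {x | ∃ (Δ p : ℤ) (v u : V), v ∈ 𝒱.wt Δ ∧ 1 ≤ p ∧ x = 𝒱.J (-Δ - p) v u}

/-! ### The current Lie algebra

`V ⊗ ℂ((ξ))` is `⨁_Δ V_Δ ⊗ ℂ((ξ)) (dξ)^{1-Δ}`, and also `⨁_Δ V_Δ ⊗ ℂ((ξ)) (dξ)^{-Δ}`: the powers
of `dξ` are only labels that record the weight `Δ`. -/

/-- The map `∇ = T(-1) ⊗ id + id ⊗ d/dξ`. -/
def nabla : V ⊗[ℂ] LaurentSeries ℂ →ₗ[ℂ] V ⊗[ℂ] LaurentSeries ℂ :=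
  TensorProduct.map (𝒱.J (-1) 𝒱.T) LinearMap.id +
    TensorProduct.map LinearMap.id (LaurentSeries.derivative ℂ)

/-- The vector space `𝔤(V)` underlying the current Lie algebra. -/
abbrev CurrentLie : Type u := (V ⊗[ℂ] LaurentSeries ℂ) ⧸ LinearMap.range 𝒱.nabla

/-- `J(v, f)`, the class of `v ⊗ f`. -/
def cur (v : V) (f : LaurentSeries ℂ) : 𝒱.CurrentLie :=
  (LinearMap.range 𝒱.nabla).mkQ (v ⊗ₜ[ℂ] f)

/-- `F^p 𝔤(V)`, spanned by `J(v, f)` with `v ∈ V_Δ` and `f ∈ ξ^{p+Δ-1} ℂ[[ξ]]`. -/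
def lieF (p : ℤ) : Submodule ℂ 𝒱.CurrentLie :=
  Submodule.span ℂ {x | ∃ (Δ : ℤ) (v : V) (f : LaurentSeries ℂ), v ∈ 𝒱.wt Δ ∧
    (∀ i < p + Δ - 1, f.coeff i = 0) ∧ x = 𝒱.cur v f}

/-- `G_p 𝔤(V)`, spanned by `J(v, f)` with `v ∈ V_Δ`, `Δ ≤ p`. -/
def lieG (p : ℤ) : Submodule ℂ 𝒱.CurrentLie :=
  Submodule.span ℂ {x | ∃ (Δ : ℤ) (v : V) (f : LaurentSeries ℂ), v ∈ 𝒱.wt Δ ∧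
    Δ ≤ p ∧ x = 𝒱.cur v f}

/-- The relations `x ⊗ y = y ⊗ x + [x, y]` of the universal enveloping algebra, for the bracket
`[J(v₁,f₁), J(v₂,f₂)] = ∑_m J(J_{m-Δ₁+1}(v₁)v₂, (1/m!) (d^m f₁/dξ^m) f₂)` of `𝔤(V)`
(`hasseDeriv m` is `(1/m!) d^m/dξ^m`). -/
inductive EnvRel : TensorAlgebra ℂ 𝒱.CurrentLie → TensorAlgebra ℂ 𝒱.CurrentLie → Prop
  | bracket (Δ₁ Δ₂ : ℤ) (v₁ v₂ : V) (f₁ f₂ : LaurentSeries ℂ)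
      (h₁ : v₁ ∈ 𝒱.wt Δ₁) (h₂ : v₂ ∈ 𝒱.wt Δ₂) :
      EnvRel
        (TensorAlgebra.ι ℂ (𝒱.cur v₁ f₁) * TensorAlgebra.ι ℂ (𝒱.cur v₂ f₂))
        (TensorAlgebra.ι ℂ (𝒱.cur v₂ f₂) * TensorAlgebra.ι ℂ (𝒱.cur v₁ f₁) +
          TensorAlgebra.ι ℂ (∑ m ∈ Finset.range (Δ₁ + Δ₂).toNat,
            𝒱.cur (𝒱.J (m - Δ₁ + 1) v₁ v₂) (LaurentSeries.hasseDeriv ℂ m f₁ * f₂)))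

/-- The universal enveloping algebra `U(𝔤(V))`. -/
def Env : Type u := RingQuot 𝒱.EnvRel

instance : Ring 𝒱.Env := inferInstanceAs (Ring (RingQuot 𝒱.EnvRel))

instance : Algebra ℂ 𝒱.Env := inferInstanceAs (Algebra ℂ (RingQuot 𝒱.EnvRel))

/-- The canonical map `𝔤(V) → U(𝔤(V))`. -/
def envι : 𝒱.CurrentLie →ₗ[ℂ] 𝒱.Env :=
  (RingQuot.mkAlgHom ℂ 𝒱.EnvRel).toLinearMap ∘ₗ TensorAlgebra.ι ℂ

/-- `F^p U(𝔤(V))`, the sum of the `F^{p₁}𝔤(V) ⋯ F^{p_r}𝔤(V)` with `p₁ + ⋯ + p_r ≥ p`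
(`r = 0` contributes `ℂ·1` when `p ≤ 0`). -/
def envF (p : ℤ) : Submodule ℂ 𝒱.Env :=
  Submodule.span ℂ {x | ∃ l : List (ℤ × 𝒱.CurrentLie), (∀ a ∈ l, a.2 ∈ 𝒱.lieF a.1) ∧
    p ≤ (l.map Prod.fst).sum ∧ x = (l.map fun a => 𝒱.envι a.2).prod}

/-- `G_p U(𝔤(V))`, the sum of the `G_{p₁}𝔤(V) ⋯ G_{p_r}𝔤(V)` with `p₁ + ⋯ + p_r ≤ p`. -/
def envG (p : ℤ) : Submodule ℂ 𝒱.Env :=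
  Submodule.span ℂ {x | ∃ l : List (ℤ × 𝒱.CurrentLie), (∀ a ∈ l, a.2 ∈ 𝒱.lieG a.1) ∧
    (l.map Prod.fst).sum ≤ p ∧ x = (l.map fun a => 𝒱.envι a.2).prod}

/-! ### The completion

`F^p_N U(𝔤(V))` is `F^p U(𝔤(V)) ∩ L_N` for the left ideal
`L_N = U(𝔤(V)) · F^N U(𝔤(V)) = U(𝔤(V)_{<0}) · F^N U(𝔤(V)_{≥0})`. The left ideals `L_N` are a
neighbourhood basis of `0` for a ring topology on `U(𝔤(V))`, and the inverse limit of the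
`F^p U(𝔤(V)) / F^p_N U(𝔤(V))` over `N` is the closure of `F^p U(𝔤(V))` in the completion. -/

/-- The left ideal `L_N` of `U(𝔤(V))` generated by `F^N U(𝔤(V))`. -/
def envL (N : ℕ) : Ideal 𝒱.Env := Ideal.span (𝒱.envF N : Set 𝒱.Env)

lemma lieF_anti {p q : ℤ} (h : p ≤ q) : 𝒱.lieF q ≤ 𝒱.lieF p := by
  refine Submodule.span_mono ?_
  rintro x ⟨Δ, v, f, hv, hf, rfl⟩
  exact ⟨Δ, v, f, hv, fun i hi => hf i (by omega), rfl⟩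

lemma envF_anti {p q : ℤ} (h : p ≤ q) : 𝒱.envF q ≤ 𝒱.envF p := by
  refine Submodule.span_mono ?_
  rintro x ⟨l, hl, hs, rfl⟩
  exact ⟨l, hl, h.trans hs, rfl⟩

lemma envL_anti {N K : ℕ} (h : N ≤ K) : 𝒱.envL K ≤ 𝒱.envL N :=
  Ideal.span_mono (𝒱.envF_anti (by exact_mod_cast h))

lemma envF_mul {p q : ℤ} {x y : 𝒱.Env} (hx : x ∈ 𝒱.envF p) (hy : y ∈ 𝒱.envF q) :
    x * y ∈ 𝒱.envF (p + q) := by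
  have h : 𝒱.envF p * 𝒱.envF q ≤ 𝒱.envF (p + q) := by
    unfold envF
    rw [Submodule.span_mul_span]
    refine Submodule.span_mono ?_
    rintro _ ⟨_, ⟨l, hl, hs, rfl⟩, _, ⟨k, hk, ht, rfl⟩, rfl⟩
    refine ⟨l ++ k, ?_, ?_, ?_⟩
    · intro a ha
      rcases List.mem_append.1 ha with h | h
      exacts [hl a h, hk a h]
    · simp only [List.map_append, List.sum_append]
      omega
    · simp
  exact h (Submodule.mul_mem_mul hx hy)

lemma one_mem_envF {p : ℤ} (hp : p ≤ 0) : (1 : 𝒱.Env) ∈ 𝒱.envF p :=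
  Submodule.subset_span ⟨[], by simp, by simpa using hp, by simp⟩

lemma exists_mem_lieF (x : 𝒱.CurrentLie) : ∃ p, x ∈ 𝒱.lieF p := by
  have hadd : ∀ x y : 𝒱.CurrentLie, (∃ p, x ∈ 𝒱.lieF p) → (∃ p, y ∈ 𝒱.lieF p) →
      ∃ p, x + y ∈ 𝒱.lieF p := by
    rintro x y ⟨p, hp⟩ ⟨q, hq⟩
    exact ⟨min p q, add_mem (𝒱.lieF_anti (min_le_left _ _) hp)
      (𝒱.lieF_anti (min_le_right _ _) hq)⟩
  obtain ⟨t, rfl⟩ := Submodule.mkQ_surjective _ x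
  induction t with
  | zero => exact ⟨0, by simp⟩
  | add x y hx hy => rw [map_add]; exact hadd _ _ hx hy
  | tmul v f =>
    have hv : v ∈ ⨆ Δ, 𝒱.wt Δ := by
      rw [𝒱.decomposition.submodule_iSup_eq_top]; trivial
    induction hv using Submodule.iSup_induction' with
    | mem Δ v hv =>
      refine ⟨f.order - Δ + 1, Submodule.subset_span ⟨Δ, v, f, hv, fun i hi => ?_, rfl⟩⟩
      exact HahnSeries.coeff_eq_zero_of_lt_order (by omega)
    | zero => exact ⟨0, by simp⟩
    | add a b _ _ ha hb => rw [TensorProduct.add_tmul, map_add]; exact hadd _ _ ha hb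

lemma exists_mem_envF (x : 𝒱.Env) : ∃ p, x ∈ 𝒱.envF p := by
  obtain ⟨t, rfl⟩ := RingQuot.mkAlgHom_surjective ℂ 𝒱.EnvRel x
  induction t using TensorAlgebra.induction with
  | algebraMap r =>
    refine ⟨0, ?_⟩
    rw [AlgHom.commutes, Algebra.algebraMap_eq_smul_one]
    exact Submodule.smul_mem _ _ (𝒱.one_mem_envF le_rfl)
  | ι x =>
    obtain ⟨p, hp⟩ := 𝒱.exists_mem_lieF x
    exact ⟨p, Submodule.subset_span ⟨[(p, x)], by simpa using hp, by simp, by simp; rfl⟩⟩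
  | mul a b ha hb =>
    obtain ⟨p, hp⟩ := ha
    obtain ⟨q, hq⟩ := hb
    exact ⟨p + q, by rw [map_mul]; exact 𝒱.envF_mul hp hq⟩
  | add a b ha hb =>
    obtain ⟨p, hp⟩ := ha
    obtain ⟨q, hq⟩ := hb
    refine ⟨min p q, ?_⟩
    rw [map_add]
    exact add_mem (𝒱.envF_anti (min_le_left _ _) hp) (𝒱.envF_anti (min_le_right _ _) hq)

lemma envL_basis : RingSubgroupsBasis fun N : ℕ => (𝒱.envL N).toAddSubgroup where
  inter i j := ⟨max i j, le_inf (𝒱.envL_anti (le_max_left _ _)) (𝒱.envL_anti (le_max_right _ _))⟩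
  mul i := by
    refine ⟨i, ?_⟩
    rintro _ ⟨x, _, y, hy, rfl⟩
    exact (𝒱.envL i).mul_mem_left x hy
  leftMul x i := ⟨i, fun _ hy => (𝒱.envL i).mul_mem_left x hy⟩
  rightMul x i := by
    obtain ⟨p, hp⟩ := 𝒱.exists_mem_envF x
    refine ⟨(i - p).toNat, fun y hy => ?_⟩
    change y * x ∈ 𝒱.envL i
    change y ∈ Ideal.span _ at hy
    induction hy using Submodule.span_induction with
    | mem y hy =>
      exact Ideal.subset_span (𝒱.envF_anti (by omega) (𝒱.envF_mul hy hp))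
    | zero => simp
    | add a b _ _ ha hb => rw [add_mul]; exact add_mem ha hb
    | smul a b _ hb => rw [smul_eq_mul, mul_assoc]; exact (𝒱.envL i).mul_mem_left a hb

instance : TopologicalSpace 𝒱.Env := 𝒱.envL_basis.topology

instance : IsTopologicalRing 𝒱.Env :=
  𝒱.envL_basis.toRingFilterBasis.isTopologicalRing

instance : UniformSpace 𝒱.Env := IsTopologicalAddGroup.rightUniformSpace 𝒱.Env

instance : IsUniformAddGroup 𝒱.Env := isUniformAddGroup_of_addCommGroup

instance : ContinuousConstSMul ℂ 𝒱.Env where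
  continuous_const_smul c := by
    simp only [Algebra.smul_def]
    exact continuous_const.mul continuous_id

instance : UniformContinuousConstSMul ℂ 𝒱.Env :=
  uniformContinuousConstSMul_of_continuousConstSMul ℂ 𝒱.Env

/-- The completion of `U(𝔤(V))` with respect to the left ideals `L_N`. -/
abbrev EnvCompl : Type u := UniformSpace.Completion 𝒱.Env

/-- The canonical map from `U(𝔤(V))` to its completion. -/
def toCompl : 𝒱.Env →ₐ[ℂ] 𝒱.EnvCompl :=
  { (UniformSpace.Completion.coeRingHom : 𝒱.Env →+* 𝒱.EnvCompl) with
    commutes' := fun _ => rfl }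

/-- `F^p Û(𝔤(V))`, the inverse limit of `F^p U(𝔤(V)) / F^p_N U(𝔤(V))` over `N`. -/
def complF (p : ℤ) : Submodule ℂ 𝒱.EnvCompl :=
  ((𝒱.envF p).map 𝒱.toCompl.toLinearMap).topologicalClosure

/-- `F^p_N Û(𝔤(V))`, the closure of `F^p_N U(𝔤(V))`. -/
def complFN (p : ℤ) (N : ℕ) : Submodule ℂ 𝒱.EnvCompl :=
  ((𝒱.envF p ⊓ (𝒱.envL N).restrictScalars ℂ).map 𝒱.toCompl.toLinearMap).topologicalClosure

/-- The filtration `G_p` of `Û(𝔤(V)) = ⋃_q F^q Û(𝔤(V))` induced by `G_p U(𝔤(V))`: the union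
over `q` of the completions of `G_p U(𝔤(V)) ∩ F^q U(𝔤(V))`. -/
def complG (p : ℤ) : Submodule ℂ 𝒱.EnvCompl :=
  ⨆ q : ℤ, ((𝒱.envG p ⊓ 𝒱.envF q).map 𝒱.toCompl.toLinearMap).topologicalClosure

lemma complF_anti {p q : ℤ} (h : p ≤ q) : 𝒱.complF q ≤ 𝒱.complF p :=
  Submodule.topologicalClosure_mono (Submodule.map_mono (𝒱.envF_anti h))

lemma complF_mul {p q : ℤ} {x y : 𝒱.EnvCompl} (hx : x ∈ 𝒱.complF p) (hy : y ∈ 𝒱.complF q) :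
    x * y ∈ 𝒱.complF (p + q) := by
  refine map_mem_closure₂ continuous_mul hx hy ?_
  rintro _ ⟨a, ha, rfl⟩ _ ⟨b, hb, rfl⟩
  exact ⟨a * b, 𝒱.envF_mul ha hb, map_mul 𝒱.toCompl a b⟩

lemma toCompl_mem_complF {p : ℤ} {x : 𝒱.Env} (hx : x ∈ 𝒱.envF p) : 𝒱.toCompl x ∈ 𝒱.complF p :=
  Submodule.le_topologicalClosure _ ⟨x, hx, rfl⟩

/-- The completed enveloping algebra `Û(𝔤(V)) = ⋃_p F^p Û(𝔤(V))`. -/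
def UHat : Subalgebra ℂ 𝒱.EnvCompl where
  carrier := {x | ∃ p : ℤ, x ∈ 𝒱.complF p}
  mul_mem' := by
    rintro x y ⟨p, hp⟩ ⟨q, hq⟩
    exact ⟨p + q, 𝒱.complF_mul hp hq⟩
  add_mem' := by
    rintro x y ⟨p, hp⟩ ⟨q, hq⟩
    exact ⟨min p q, add_mem (𝒱.complF_anti (min_le_left _ _) hp)
      (𝒱.complF_anti (min_le_right _ _) hq)⟩
  algebraMap_mem' := by
    intro r
    refine ⟨0, ?_⟩
    rw [Algebra.algebraMap_eq_smul_one]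
    refine Submodule.smul_mem _ _ ?_
    rw [← map_one 𝒱.toCompl]
    exact 𝒱.toCompl_mem_complF (𝒱.one_mem_envF le_rfl)

/-- The canonical map `U(𝔤(V)) → Û(𝔤(V))`. -/
def toUHat : 𝒱.Env →ₐ[ℂ] 𝒱.UHat :=
  𝒱.toCompl.codRestrict 𝒱.UHat fun x =>
    (𝒱.exists_mem_envF x).imp fun _ hp => 𝒱.toCompl_mem_complF hp

/-- For `v ∈ V_Δ`, the element `J_n(v) = J(v, ξ^{n+Δ-1})` of `Û(𝔤(V))`. -/
def modeHat (Δ n : ℤ) (v : V) : 𝒱.UHat :=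
  𝒱.toUHat (𝒱.envι (𝒱.cur v (HahnSeries.single (n + Δ - 1) (1 : ℂ))))

/-! ### The current algebra and its modules -/

/-- The relations `J_0(|0⟩) = 1` and `J_m(J_n(v₁)v₂) = ∑_j ⋯` (associativity), the latter an
infinite sum in `Û(𝔤(V))`. Note `J_n(v₁)v₂ ∈ V_{Δ₂-n}`. -/
inductive CurrentRel : 𝒱.UHat → 𝒱.UHat → Prop
  | vac : CurrentRel (𝒱.modeHat 0 0 𝒱.vac) 1
  | assoc (Δ₁ Δ₂ : ℤ) (v₁ v₂ : V) (m n : ℤ) (s : 𝒱.UHat)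
      (h₁ : v₁ ∈ 𝒱.wt Δ₁) (h₂ : v₂ ∈ 𝒱.wt Δ₂)
      (hs : HasSum (fun j : ℕ => ((-1 : ℂ) ^ j * ((Ring.choose (n + Δ₁ - 1) j : ℤ) : ℂ)) •
        (𝒱.modeHat Δ₁ (n - j) v₁ * 𝒱.modeHat Δ₂ (m - n + j) v₂
          - (-1 : ℂ) ^ (n + Δ₁ - 1) •
            (𝒱.modeHat Δ₂ (m + Δ₁ - j - 1) v₂ * 𝒱.modeHat Δ₁ (j - Δ₁ + 1) v₁))) s) :
      CurrentRel (𝒱.modeHat (Δ₂ - n) m (𝒱.J n v₁ v₂)) s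

/-- The current algebra `𝒰(V)`, the quotient of `Û(𝔤(V))` by the two-sided ideal generated by
the relations `CurrentRel`. -/
def CurrentAlgebra : Type u := RingQuot 𝒱.CurrentRel

instance : Ring 𝒱.CurrentAlgebra := inferInstanceAs (Ring (RingQuot 𝒱.CurrentRel))

instance : Algebra ℂ 𝒱.CurrentAlgebra := inferInstanceAs (Algebra ℂ (RingQuot 𝒱.CurrentRel))

/-- The projection `Û(𝔤(V)) → 𝒰(V)`. -/
def toCurrent : 𝒱.UHat →ₐ[ℂ] 𝒱.CurrentAlgebra := RingQuot.mkAlgHom ℂ 𝒱.CurrentRel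

/-- For `v ∈ V_Δ`, the element `J_n(v)` of `𝒰(V)`. -/
def mode (Δ n : ℤ) (v : V) : 𝒱.CurrentAlgebra := 𝒱.toCurrent (𝒱.modeHat Δ n v)

/-- The image in `𝒰(V)` of a subspace of `Û(𝔤(V))`, the latter given inside `EnvCompl`. -/
def image (S : Submodule ℂ 𝒱.EnvCompl) : Submodule ℂ 𝒱.CurrentAlgebra :=
  (S.comap 𝒱.UHat.val.toLinearMap).map 𝒱.toCurrent.toLinearMap

/-- `F^p 𝒰(V)`. -/
def curF (p : ℤ) : Submodule ℂ 𝒱.CurrentAlgebra := 𝒱.image (𝒱.complF p)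

/-- `F^p_N 𝒰(V)`, the image of `F^p_N Û(𝔤(V))`. -/
def curFN (p : ℤ) (N : ℕ) : Submodule ℂ 𝒱.CurrentAlgebra := 𝒱.image (𝒱.complFN p N)

/-- `G_p 𝒰(V)`. -/
def curG (p : ℤ) : Submodule ℂ 𝒱.CurrentAlgebra := 𝒱.image (𝒱.complG p)

variable (M : Type v) [AddCommGroup M] [Module ℂ M] [Module 𝒱.CurrentAlgebra M]
  [IsScalarTower ℂ 𝒱.CurrentAlgebra M]

/-- `M` is a `V`-module. -/
structure IsVModule : Prop where
  /-- `M` is finitely generated over `𝒰(V)`. -/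
  fg : Module.Finite 𝒱.CurrentAlgebra M
  /-- `F^0 𝒰(V) m` is finite dimensional. -/
  finite_F : ∀ m : M, FiniteDimensional ℂ
    ((𝒱.curF 0).map ((LinearMap.toSpanSingleton 𝒱.CurrentAlgebra M m).restrictScalars ℂ))
  /-- The topological algebra `𝒰(V)` acts continuously on the discrete space `M`, i.e. the
  linear map `F^p 𝒰(V) → M`, `x ↦ x m`, is continuous for the linear topology defined by the
  `F^p_N 𝒰(V)`. -/
  continuous : ∀ (m : M) (p : ℤ), ∃ N : ℕ, ∀ x ∈ 𝒱.curFN p N, x • m = 0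

variable {M}

/-- A subspace `W` from which a good filtration of `M` is built: a finite dimensional
`F^0 𝒰(V)`-submodule that generates `M` over `𝒰(V)`, i.e. for which
`𝒰(V) ⊗_{F^0 𝒰(V)} W → M` is surjective. -/
structure IsGoodGenerator (W : Submodule ℂ M) : Prop where
  finite : FiniteDimensional ℂ W
  smul_mem : ∀ x ∈ 𝒱.curF 0, ∀ w ∈ W, x • w ∈ W
  span_eq_top : Submodule.span 𝒱.CurrentAlgebra (W : Set M) = ⊤

/-- The good filtration of `M` defined by `W`: `G_p M = G_p 𝒰(V) W` for `p ≥ 0` and `G_p M = 0`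
for `p < 0`. -/
def goodFiltration (W : Submodule ℂ M) (p : ℤ) : Submodule ℂ M :=
  if p < 0 then ⊥ else Submodule.span ℂ {y | ∃ x ∈ 𝒱.curG p, ∃ w ∈ W, y = x • w}

/-- `gr_p^G M = G_p M / G_{p-1} M`. -/
abbrev gr (W : Submodule ℂ M) (p : ℤ) : Type v :=
  𝒱.goodFiltration W p ⧸ (𝒱.goodFiltration W (p - 1)).submoduleOf (𝒱.goodFiltration W p)

end ChiralVOA

end

/-!
In the associated graded module of the good filtration three things happen.

* The modes commute, because every term of the commutator formula has smaller weight than the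
  product (`commutator_smul_mem`). Hence `J_n(v)` with `n ≥ 0` and `v` of positive weight acts by
  zero: it can be moved to the right, where it preserves `W`
  (`IsGoodGenerator.mode_smul_mem_of_nonneg`).
* The modes of `C₂(V)` act by zero, because associativity writes `J_m(J_{-Δ₁-k}(v₁)v₂)`, of weight
  `Δ₁ + Δ₂ + k`, through products of modes of `v₁` and `v₂`, of weight `Δ₁ + Δ₂`
  (`IsVModule.mode_C2wt_smul_mem`). As the vacuum acts by a scalar, only modes of `U` remain.
* Associativity for `J_{-Δ₁}(v₁)v₂` becomes the convolution formula
  `J_m(J_{-Δ₁}(v₁)v₂) = ∑_{a+b=m} J_a(v₁) J_b(v₂)`, in which only `a, b < 0` contribute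
  (`IsVModule.mode_normalProduct_smul_sub_mem`).

So the graded piece is spanned by ordered monomials in negative modes of `U`. If an index occurs
twice, the convolution formula with `m = 2n` replaces `J_n(v₁) J_n(v₂)` by a single mode `J_{2n}` and
by products `J_a(v₁) J_{2n-a}(v₂)` with `a ≠ n`. These have the same sum of indices and a larger sum
of squares, which is bounded by the square of the sum; the rewriting therefore ends, with distinct
indices (`IsVModule.modeProd_smul_mem_strictSpan`).

The completions enter only through the action on single vectors. By continuity each vector of `M` is
killed by a deep enough `F^p_N 𝒰(V)`, so that on a given vector an element of `G_p 𝒰(V)` acts as a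
finite combination of products of modes (`IsVModule.goodFiltration_eq`), and the associativity
relation, whose infinite sum converges in the completion, becomes a finite sum
(`IsVModule.associativity`).
-/

noncomputable section

namespace ChiralVOA

universe u v

section

variable {V : Type u} [AddCommGroup V] [Module ℂ V] (𝒱 : ChiralVOA V)

/-! ### Relations among the modes -/

/-- The canonical map `𝔤(V) → 𝒰(V)`. -/
def lieToCurrent : 𝒱.CurrentLie →ₗ[ℂ] 𝒱.CurrentAlgebra :=
  𝒱.toCurrent.toLinearMap ∘ₗ 𝒱.toUHat.toLinearMap ∘ₗ 𝒱.envι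

lemma lieToCurrent_apply (x : 𝒱.CurrentLie) :
    𝒱.lieToCurrent x = 𝒱.toCurrent (𝒱.toUHat (𝒱.envι x)) := rfl

lemma mode_eq_lieToCurrent (Δ n : ℤ) (v : V) :
    𝒱.mode Δ n v = 𝒱.lieToCurrent (𝒱.cur v (HahnSeries.single (n + Δ - 1) (1 : ℂ))) := rfl

lemma cur_add_left (v w : V) (f : LaurentSeries ℂ) :
    𝒱.cur (v + w) f = 𝒱.cur v f + 𝒱.cur w f := by
  simp only [cur, TensorProduct.add_tmul, map_add]

lemma cur_smul_left (c : ℂ) (v : V) (f : LaurentSeries ℂ) :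
    𝒱.cur (c • v) f = c • 𝒱.cur v f := by
  simp only [cur, ← TensorProduct.smul_tmul', map_smul]

lemma cur_add_right (v : V) (f g : LaurentSeries ℂ) :
    𝒱.cur v (f + g) = 𝒱.cur v f + 𝒱.cur v g := by
  simp only [cur, TensorProduct.tmul_add, map_add]

lemma cur_smul_right (c : ℂ) (v : V) (f : LaurentSeries ℂ) :
    𝒱.cur v (c • f) = c • 𝒱.cur v f := by
  simp only [cur, TensorProduct.tmul_smul, map_smul]

lemma cur_sum_right {ι : Type*} (s : Finset ι) (v : V) (f : ι → LaurentSeries ℂ) :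
    𝒱.cur v (∑ i ∈ s, f i) = ∑ i ∈ s, 𝒱.cur v (f i) := by
  simp only [cur, TensorProduct.tmul_sum, map_sum]

lemma cur_translation (v : V) (f : LaurentSeries ℂ) :
    𝒱.cur (𝒱.J (-1) 𝒱.T v) f + 𝒱.cur v (LaurentSeries.derivative ℂ f) = 0 := by
  rw [cur, cur, ← map_add, Submodule.mkQ_apply, Submodule.Quotient.mk_eq_zero]
  exact ⟨v ⊗ₜ f, by simp [nabla]⟩

lemma mode_add (Δ n : ℤ) (v w : V) : 𝒱.mode Δ n (v + w) = 𝒱.mode Δ n v + 𝒱.mode Δ n w := by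
  simp only [mode_eq_lieToCurrent, cur_add_left, map_add]

lemma mode_smul (Δ n : ℤ) (c : ℂ) (v : V) : 𝒱.mode Δ n (c • v) = c • 𝒱.mode Δ n v := by
  simp only [mode_eq_lieToCurrent, cur_smul_left, map_smul]

lemma mode_zero (Δ n : ℤ) : 𝒱.mode Δ n 0 = 0 := by
  simpa using 𝒱.mode_smul Δ n 0 0

lemma mode_zero_vac : 𝒱.mode 0 0 𝒱.vac = 1 := by
  have := RingQuot.mkAlgHom_rel ℂ (CurrentRel.vac (𝒱 := 𝒱))
  rw [map_one] at this
  exact this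

/-- Since `T(-1)|0⟩ = 0`, the class `J(|0⟩, f')` vanishes for every `f`, and `ξ^{n-1}` is a
derivative for `n ≠ 0`. -/
lemma mode_vac {n : ℤ} (hn : n ≠ 0) : 𝒱.mode 0 n 𝒱.vac = 0 := by
  have h := 𝒱.cur_translation 𝒱.vac (HahnSeries.single n (1 : ℂ))
  rw [𝒱.J_apply_vac_of_lt 2 𝒱.T 𝒱.T_mem (-1) (by norm_num), LaurentSeries.derivative_apply,
    LaurentSeries.hasseDeriv_single] at h
  have h0 : 𝒱.cur 0 (HahnSeries.single n (1 : ℂ)) = 0 := by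
    simpa using 𝒱.cur_smul_left 0 0 (HahnSeries.single n (1 : ℂ))
  have h1 : (HahnSeries.single (n - ((1 : ℕ) : ℤ)) (Ring.choose n 1 • (1 : ℂ)) : LaurentSeries ℂ) =
      (n : ℂ) • HahnSeries.single (n + 0 - 1) (1 : ℂ) := by
    ext i
    simp [HahnSeries.coeff_single]
  rw [h0, zero_add, h1, cur_smul_right] at h
  rw [mode_eq_lieToCurrent, (smul_eq_zero.mp h).resolve_left (by exact_mod_cast hn), map_zero]

lemma lieToCurrent_bracket {Δ₁ Δ₂ : ℤ} {v₁ v₂ : V} (h₁ : v₁ ∈ 𝒱.wt Δ₁) (h₂ : v₂ ∈ 𝒱.wt Δ₂)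
    (f₁ f₂ : LaurentSeries ℂ) :
    𝒱.lieToCurrent (𝒱.cur v₁ f₁) * 𝒱.lieToCurrent (𝒱.cur v₂ f₂) =
      𝒱.lieToCurrent (𝒱.cur v₂ f₂) * 𝒱.lieToCurrent (𝒱.cur v₁ f₁) +
        𝒱.lieToCurrent (∑ m ∈ Finset.range (Δ₁ + Δ₂).toNat,
            𝒱.cur (𝒱.J (m - Δ₁ + 1) v₁ v₂) (LaurentSeries.hasseDeriv ℂ m f₁ * f₂)) := by
  have h := RingQuot.mkAlgHom_rel ℂ (EnvRel.bracket (𝒱 := 𝒱) Δ₁ Δ₂ v₁ v₂ f₁ f₂ h₁ h₂)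
  rw [map_mul, map_add, map_mul] at h
  have h' : 𝒱.envι (𝒱.cur v₁ f₁) * 𝒱.envι (𝒱.cur v₂ f₂) =
      𝒱.envι (𝒱.cur v₂ f₂) * 𝒱.envι (𝒱.cur v₁ f₁) +
        𝒱.envι (∑ m ∈ Finset.range (Δ₁ + Δ₂).toNat,
            𝒱.cur (𝒱.J (m - Δ₁ + 1) v₁ v₂) (LaurentSeries.hasseDeriv ℂ m f₁ * f₂)) := h
  simp only [lieToCurrent_apply, ← map_mul, ← map_add, h']

lemma mode_mul_mode {Δ₁ Δ₂ : ℤ} {v₁ v₂ : V} (h₁ : v₁ ∈ 𝒱.wt Δ₁) (h₂ : v₂ ∈ 𝒱.wt Δ₂) (m n : ℤ) :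
    𝒱.mode Δ₁ m v₁ * 𝒱.mode Δ₂ n v₂ = 𝒱.mode Δ₂ n v₂ * 𝒱.mode Δ₁ m v₁ +
      ∑ j ∈ Finset.range (Δ₁ + Δ₂).toNat, ((Ring.choose (m + Δ₁ - 1) j : ℤ) : ℂ) •
        𝒱.mode (Δ₂ - (j - Δ₁ + 1)) (m + n) (𝒱.J (j - Δ₁ + 1) v₁ v₂) := by
  simp only [mode_eq_lieToCurrent]
  rw [𝒱.lieToCurrent_bracket h₁ h₂, map_sum]
  congr 1
  refine Finset.sum_congr rfl fun j _ => ?_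
  rw [← map_smul, ← cur_smul_right, LaurentSeries.hasseDeriv_single, HahnSeries.single_mul_single]
  congr 2
  have : m + Δ₁ - 1 - (j : ℤ) + (n + Δ₂ - 1) = m + n + (Δ₂ - (j - Δ₁ + 1)) - 1 := by ring
  rw [this]
  ext i
  simp [HahnSeries.coeff_single]

/-! ### Degrees in the enveloping algebra -/

lemma single_mem_lieF {Δ : ℤ} {v : V} (hv : v ∈ 𝒱.wt Δ) (n : ℤ) :
    𝒱.cur v (HahnSeries.single (n + Δ - 1) (1 : ℂ)) ∈ 𝒱.lieF n :=
  Submodule.subset_span ⟨Δ, v, _, hv, fun _ hi => HahnSeries.coeff_single_of_ne hi.ne, rfl⟩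

lemma single_mem_lieG {Δ : ℤ} {v : V} (hv : v ∈ 𝒱.wt Δ) (n : ℤ) :
    𝒱.cur v (HahnSeries.single (n + Δ - 1) (1 : ℂ)) ∈ 𝒱.lieG Δ :=
  Submodule.subset_span ⟨Δ, v, _, hv, le_rfl, rfl⟩

lemma envι_mem_envF {p : ℤ} {x : 𝒱.CurrentLie} (hx : x ∈ 𝒱.lieF p) : 𝒱.envι x ∈ 𝒱.envF p :=
  Submodule.subset_span ⟨[(p, x)], by simpa using hx, by simp, by simp⟩

lemma envF_le_envL {p : ℤ} {N : ℕ} (h : N ≤ p) {x : 𝒱.Env} (hx : x ∈ 𝒱.envF p) :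
    x ∈ 𝒱.envL N :=
  Ideal.subset_span (𝒱.envF_anti h hx)

end

section

variable {V : Type u} [AddCommGroup V] [Module ℂ V] (𝒱 : ChiralVOA V)

open Filter Topology

/-! ### Approximation and convergence in the completion -/

lemma envL_mem_nhds (N : ℕ) : (𝒱.envL N : Set 𝒱.Env) ∈ 𝓝 (0 : 𝒱.Env) :=
  (𝒱.envL_basis.hasBasis_nhds_zero).mem_of_mem (i := N) trivial

instance : NonarchimedeanRing 𝒱.Env := 𝒱.envL_basis.nonarchimedean

/-- Two elements of `F^q U(𝔤(V))` close to the same point of the completion differ by an element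
of the open left ideal `L_N`, hence by an element of `F^q_N U(𝔤(V))`. -/
lemma exists_sub_mem_complFN {S : Submodule ℂ 𝒱.Env} {q : ℤ} (hS : S ≤ 𝒱.envF q)
    {z : 𝒱.EnvCompl} (hz : z ∈ (S.map 𝒱.toCompl.toLinearMap).topologicalClosure) (N : ℕ) :
    ∃ a ∈ S, z - 𝒱.toCompl a ∈ 𝒱.complFN q N := by
  -- the topology of `U(𝔤(V))` is induced, so `L_N` contains the trace of a neighbourhood `O` of `0`
  have hL := 𝒱.envL_mem_nhds N
  rw [(UniformSpace.Completion.isDenseInducing_coe (α := 𝒱.Env)).nhds_eq_comap,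
    UniformSpace.Completion.coe_zero] at hL
  obtain ⟨O, hO, hOL⟩ := mem_comap.1 hL
  have hsub : Tendsto (fun y : 𝒱.EnvCompl × 𝒱.EnvCompl => y.1 - y.2) (𝓝 z ×ˢ 𝓝 z) (𝓝 0) := by
    rw [← nhds_prod_eq, ← sub_self z]
    exact (continuous_fst.sub continuous_snd).tendsto (z, z)
  obtain ⟨P, hP, hPO⟩ := mem_prod_same_iff.1 (hsub hO)
  have hz' : z ∈ closure (((S.map 𝒱.toCompl.toLinearMap : Submodule ℂ 𝒱.EnvCompl) :
      Set 𝒱.EnvCompl)) := hz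
  obtain ⟨_, haP, a, ha, rfl⟩ := mem_closure_iff_nhds.1 hz' P hP
  refine ⟨a, ha, ?_⟩
  change _ ∈ closure (_ : Set 𝒱.EnvCompl)
  rw [mem_closure_iff_nhds]
  intro t ht
  have hshift : (fun y => y - 𝒱.toCompl a) ⁻¹' t ∈ 𝓝 z :=
    (continuous_id.sub continuous_const).continuousAt.preimage_mem_nhds ht
  obtain ⟨_, ⟨hbt, hbP⟩, b, hb, rfl⟩ := mem_closure_iff_nhds.1 hz' _ (inter_mem hshift hP)
  refine ⟨𝒱.toCompl (b - a), ?_, b - a, ⟨sub_mem (hS hb) (hS ha), ?_⟩, rfl⟩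
  · rw [map_sub]; exact hbt
  · refine hOL ?_
    have := hPO (Set.mk_mem_prod hbP haP)
    change _ ∈ O at this
    change ((b - a : 𝒱.Env) : 𝒱.EnvCompl) ∈ O
    rw [UniformSpace.Completion.coe_sub]
    exact this

/-- A sequence in `F^q U(𝔤(V))` that tends to `0` has a sum in `Û(𝔤(V))`, and its tails lie in
`F^q_N Û(𝔤(V))`. -/
lemma exists_hasSum_toUHat {q : ℤ} {f : ℕ → 𝒱.Env} (hf : ∀ j, f j ∈ 𝒱.envF q)
    (h0 : ∀ N : ℕ, ∃ K, ∀ j ≥ K, f j ∈ 𝒱.envL N) :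
    ∃ s : 𝒱.UHat, HasSum (fun j => 𝒱.toUHat (f j)) s ∧
      ∀ N : ℕ, ∃ K, ∀ k ≥ K,
        ((s - 𝒱.toUHat (∑ j ∈ Finset.range k, f j) : 𝒱.UHat) : 𝒱.EnvCompl) ∈ 𝒱.complFN q N := by
  have htend : Tendsto f atTop (𝓝 0) := by
    rw [(𝒱.envL_basis.hasBasis_nhds_zero).tendsto_right_iff]
    intro N _
    obtain ⟨K, hK⟩ := h0 N
    exact eventually_atTop.2 ⟨K, hK⟩
  have htend' : Tendsto (fun j => 𝒱.toCompl (f j)) cofinite (𝓝 0) := by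
    rw [Nat.cofinite_eq_atTop]
    have := (UniformSpace.Completion.continuous_coe 𝒱.Env).tendsto 0 |>.comp htend
    rwa [UniformSpace.Completion.coe_zero] at this
  obtain ⟨z, hz⟩ := NonarchimedeanAddGroup.summable_of_tendsto_cofinite_zero htend'
  have hlim := hz.tendsto_sum_nat
  have hzF : z ∈ 𝒱.complF q :=
    mem_closure_of_tendsto hlim (Eventually.of_forall fun k =>
      ⟨∑ j ∈ Finset.range k, f j, Submodule.sum_mem _ fun j _ => hf j, map_sum 𝒱.toCompl _ _⟩)
  refine ⟨⟨z, q, hzF⟩, ?_, fun N => ?_⟩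
  · exact (Topology.IsInducing.subtypeVal.hasSum_iff (g := 𝒱.UHat.val) _ _).1 hz
  · obtain ⟨K, hK⟩ := h0 N
    refine ⟨K, fun k hk => ?_⟩
    change z - 𝒱.toCompl _ ∈ closure _
    refine mem_closure_of_tendsto (hlim.sub_const _) (eventually_atTop.2 ⟨k, fun l hl => ?_⟩)
    refine ⟨∑ j ∈ Finset.Ico k l, f j, ⟨Submodule.sum_mem _ fun j _ => hf j,
      Submodule.sum_mem _ fun j hj => hK j (hk.trans (Finset.mem_Ico.1 hj).1)⟩, ?_⟩
    change 𝒱.toCompl _ = _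
    rw [Finset.sum_Ico_eq_sub _ hl, map_sub, map_sum]

lemma mem_complG_iff {p : ℤ} {z : 𝒱.EnvCompl} : z ∈ 𝒱.complG p ↔ ∃ q : ℤ,
    z ∈ ((𝒱.envG p ⊓ 𝒱.envF q).map 𝒱.toCompl.toLinearMap).topologicalClosure := by
  refine Submodule.mem_iSup_of_directed _ (Antitone.directed_le fun q r h => ?_)
  exact Submodule.topologicalClosure_mono
    (Submodule.map_mono (inf_le_inf_left _ (𝒱.envF_anti h)))

/-! ### The action on a module -/

lemma smul_eq_smul_of_sub_mem {M : Type v} [AddCommGroup M] [Module 𝒱.CurrentAlgebra M] {m : M}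
    {q : ℤ} {N : ℕ} (hN : ∀ x ∈ 𝒱.curFN q N, x • m = 0) {s t : 𝒱.UHat}
    (h : ((s - t : 𝒱.UHat) : 𝒱.EnvCompl) ∈ 𝒱.complFN q N) :
    𝒱.toCurrent s • m = 𝒱.toCurrent t • m := by
  rw [← sub_eq_zero, ← sub_smul, ← map_sub]
  exact hN _ ⟨_, h, rfl⟩

variable {M : Type v} [AddCommGroup M] [Module ℂ M] [Module 𝒱.CurrentAlgebra M]
  [IsScalarTower ℂ 𝒱.CurrentAlgebra M]

variable {𝒱}

/-- Each vector of a `V`-module is killed by `F^N 𝔤(V)` for `N` large. -/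
lemma IsVModule.exists_lieF_smul_eq_zero (hM : 𝒱.IsVModule M) (m : M) :
    ∃ N : ℕ, ∀ x ∈ 𝒱.lieF N, 𝒱.lieToCurrent x • m = 0 := by
  obtain ⟨N, hN⟩ := hM.continuous m 0
  refine ⟨N, fun x hx => hN _ ⟨_, ?_, rfl⟩⟩
  have hx' := 𝒱.envι_mem_envF hx
  exact Submodule.le_topologicalClosure _
    ⟨_, ⟨𝒱.envF_anti (by positivity) hx', 𝒱.envF_le_envL le_rfl hx'⟩, rfl⟩

/-- On a vector of a `V`-module the associativity relation is a finite sum. -/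
lemma IsVModule.associativity (hM : 𝒱.IsVModule M) {Δ₁ Δ₂ : ℤ} {v₁ v₂ : V}
    (h₁ : v₁ ∈ 𝒱.wt Δ₁) (h₂ : v₂ ∈ 𝒱.wt Δ₂) (m n : ℤ) (x : M) :
    ∃ K : ℕ, ∀ k ≥ K, 𝒱.mode (Δ₂ - n) m (𝒱.J n v₁ v₂) • x =
      ∑ j ∈ Finset.range k, ((-1 : ℂ) ^ j * ((Ring.choose (n + Δ₁ - 1) j : ℤ) : ℂ)) •
        (𝒱.mode Δ₁ (n - j) v₁ • 𝒱.mode Δ₂ (m - n + j) v₂ • x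
          - (-1 : ℂ) ^ (n + Δ₁ - 1) •
            𝒱.mode Δ₂ (m + Δ₁ - j - 1) v₂ • 𝒱.mode Δ₁ (j - Δ₁ + 1) v₁ • x) := by
  let e (Δ k : ℤ) (v : V) : 𝒱.Env := 𝒱.envι (𝒱.cur v (HahnSeries.single (k + Δ - 1) (1 : ℂ)))
  have he {Δ : ℤ} {v : V} (hv : v ∈ 𝒱.wt Δ) (k : ℤ) : e Δ k v ∈ 𝒱.envF k :=
    𝒱.envι_mem_envF (𝒱.single_mem_lieF hv k)
  let f (j : ℕ) : 𝒱.Env := ((-1 : ℂ) ^ j * ((Ring.choose (n + Δ₁ - 1) j : ℤ) : ℂ)) •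
    (e Δ₁ (n - j) v₁ * e Δ₂ (m - n + j) v₂ - (-1 : ℂ) ^ (n + Δ₁ - 1) •
      (e Δ₂ (m + Δ₁ - j - 1) v₂ * e Δ₁ (j - Δ₁ + 1) v₁))
  have hfF (j : ℕ) : f j ∈ 𝒱.envF m := by
    refine Submodule.smul_mem _ _ (sub_mem ?_ (Submodule.smul_mem _ _ ?_))
    · exact 𝒱.envF_anti (by omega) (𝒱.envF_mul (he h₁ _) (he h₂ _))
    · exact 𝒱.envF_anti (by omega) (𝒱.envF_mul (he h₂ _) (he h₁ _))
  have hf0 (N : ℕ) : ∃ K, ∀ j ≥ K, f j ∈ 𝒱.envL N := by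
    refine ⟨N + m.natAbs + n.natAbs + Δ₁.natAbs, fun j hj => ?_⟩
    have hsmul (c : ℂ) {y : 𝒱.Env} (hy : y ∈ 𝒱.envL N) : c • y ∈ 𝒱.envL N :=
      ((𝒱.envL N).restrictScalars ℂ).smul_mem c hy
    refine hsmul _ (sub_mem ?_ (hsmul _ ?_))
    · refine Ideal.mul_mem_left _ _ (𝒱.envF_le_envL ?_ (he h₂ _))
      omega
    · refine Ideal.mul_mem_left _ _ (𝒱.envF_le_envL ?_ (he h₁ _))
      omega
  obtain ⟨s, hs, htail⟩ := 𝒱.exists_hasSum_toUHat hfF hf0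
  have hrel : 𝒱.mode (Δ₂ - n) m (𝒱.J n v₁ v₂) = 𝒱.toCurrent s := by
    refine RingQuot.mkAlgHom_rel ℂ (CurrentRel.assoc Δ₁ Δ₂ v₁ v₂ m n s h₁ h₂ ?_)
    refine hs.congr_fun fun j => ?_
    simp only [f, map_smul, map_sub, map_mul]
    rfl
  obtain ⟨N, hN⟩ := hM.continuous x m
  obtain ⟨K, hK⟩ := htail N
  refine ⟨K, fun k hk => ?_⟩
  rw [hrel, 𝒱.smul_eq_smul_of_sub_mem hN (hK k hk), map_sum, map_sum, Finset.sum_smul]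
  refine Finset.sum_congr rfl fun j _ => ?_
  simp only [f, map_smul, map_sub, map_mul, sub_smul, smul_assoc, mul_smul]
  rfl

end

section

variable {V : Type u} [AddCommGroup V] [Module ℂ V] (𝒱 : ChiralVOA V)
variable {M : Type v} [AddCommGroup M] [Module ℂ M] [Module 𝒱.CurrentAlgebra M]

/-! ### The good filtration in terms of modes -/

/-- The product `J_{n₁}(v₁) ⋯ J_{n_r}(v_r)` in `𝒰(V)` of a list of triples `(Δ, n, v)`; a triple
stands for `J_n(v)` and is meant to satisfy `v ∈ V_Δ`. -/
def modeProd (l : List (ℤ × ℤ × V)) : 𝒱.CurrentAlgebra :=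
  (l.map fun a => 𝒱.mode a.1 a.2.1 a.2.2).prod

@[simp] lemma modeProd_nil : 𝒱.modeProd [] = 1 := rfl

@[simp] lemma modeProd_cons (a : ℤ × ℤ × V) (l : List (ℤ × ℤ × V)) :
    𝒱.modeProd (a :: l) = 𝒱.mode a.1 a.2.1 a.2.2 * 𝒱.modeProd l := by
  simp [modeProd]

/-- The span of the vectors `J_{n₁}(v₁) ⋯ J_{n_r}(v_r) w` with `w ∈ W`, `vᵢ ∈ V_{Δᵢ}` and
`Δ₁ + ⋯ + Δ_r ≤ p`. -/
def weightFiltration (W : Submodule ℂ M) (p : ℤ) : Submodule ℂ M :=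
  Submodule.span ℂ {y | ∃ l : List (ℤ × ℤ × V), (∀ a ∈ l, a.2.2 ∈ 𝒱.wt a.1) ∧
    (l.map Prod.fst).sum ≤ p ∧ ∃ w ∈ W, y = 𝒱.modeProd l • w}

variable {𝒱}

variable {W : Submodule ℂ M}

lemma weightFiltration_mono {p q : ℤ} (h : p ≤ q) :
    𝒱.weightFiltration W p ≤ 𝒱.weightFiltration W q := by
  refine Submodule.span_mono ?_
  rintro y ⟨l, hl, hs, hw⟩
  exact ⟨l, hl, hs.trans h, hw⟩

lemma modeProd_smul_mem {l : List (ℤ × ℤ × V)} (hl : ∀ a ∈ l, a.2.2 ∈ 𝒱.wt a.1) {w : M}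
    (hw : w ∈ W) : 𝒱.modeProd l • w ∈ 𝒱.weightFiltration W (l.map Prod.fst).sum :=
  Submodule.subset_span ⟨l, hl, le_rfl, w, hw, rfl⟩

lemma mem_weightFiltration_of_mem {p : ℤ} (hp : 0 ≤ p) {w : M} (hw : w ∈ W) :
    w ∈ 𝒱.weightFiltration W p :=
  Submodule.subset_span ⟨[], by simp, by simpa using hp, w, hw, by simp⟩

lemma eq_zero_of_mem_wt_neg {Δ : ℤ} (hΔ : Δ < 0) {v : V} (hv : v ∈ 𝒱.wt Δ) : v = 0 := by
  rwa [𝒱.wt_neg Δ hΔ, Submodule.mem_bot] at hv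

/-- A monomial of negative total weight has a factor of negative weight, which vanishes. -/
lemma weightFiltration_of_neg {p : ℤ} (hp : p < 0) : 𝒱.weightFiltration W p = ⊥ := by
  rw [eq_bot_iff]
  refine Submodule.span_le.2 ?_
  rintro _ ⟨l, hl, hs, w, hw, rfl⟩
  obtain ⟨a, ha, hneg⟩ : ∃ a ∈ l, a.1 < 0 := by
    by_contra! h
    have : 0 ≤ (l.map Prod.fst).sum := List.sum_nonneg (by simpa using fun x y z hx => h _ hx)
    omega
  have : 𝒱.modeProd l = 0 := by
    refine List.prod_eq_zero (List.mem_map.2 ⟨a, ha, ?_⟩)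
    rw [eq_zero_of_mem_wt_neg hneg (hl a ha), mode_zero]
  simp [this]

lemma IsGoodGenerator.mode_smul_mem (hW : 𝒱.IsGoodGenerator W) {Δ n : ℤ} (hn : 0 ≤ n) {v : V}
    (hv : v ∈ 𝒱.wt Δ) {w : M} (hw : w ∈ W) : 𝒱.mode Δ n v • w ∈ W :=
  hW.smul_mem _ ⟨_, 𝒱.toCompl_mem_complF (𝒱.envF_anti hn
    (𝒱.envι_mem_envF (𝒱.single_mem_lieF hv n))), rfl⟩ _ hw

variable [IsScalarTower ℂ 𝒱.CurrentAlgebra M]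

lemma smul_mem_of_mem_span {s : Set M} {P : Submodule ℂ M} (a : 𝒱.CurrentAlgebra)
    (h : ∀ y ∈ s, a • y ∈ P) {x : M} (hx : x ∈ Submodule.span ℂ s) : a • x ∈ P :=
  (show Submodule.span ℂ s ≤ P.comap (Algebra.lsmul ℂ ℂ M a) from Submodule.span_le.2 h) hx

lemma mode_smul_mem {Δ : ℤ} {v : V} (hv : v ∈ 𝒱.wt Δ) (n : ℤ) {q r : ℤ} (h : q + Δ ≤ r) {x : M}
    (hx : x ∈ 𝒱.weightFiltration W q) : 𝒱.mode Δ n v • x ∈ 𝒱.weightFiltration W r := by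
  refine smul_mem_of_mem_span _ ?_ hx
  rintro _ ⟨l, hl, hs, w, hw, rfl⟩
  refine Submodule.subset_span ⟨(Δ, n, v) :: l, ?_, ?_, w, hw, ?_⟩
  · simpa [hv] using hl
  · simp only [List.map_cons, List.sum_cons]; omega
  · simp [mul_smul]

/-- On a given vector, a current acts as a finite linear combination of modes: a Laurent series
differs from a Laurent polynomial by a series of high order. -/
lemma IsVModule.lieToCurrent_smul_mem (hM : 𝒱.IsVModule M) {q r : ℤ} {x : 𝒱.CurrentLie}
    (hx : x ∈ 𝒱.lieG r) {m : M} (hm : m ∈ 𝒱.weightFiltration W q) :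
    𝒱.lieToCurrent x • m ∈ 𝒱.weightFiltration W (q + r) := by
  suffices h : 𝒱.lieG r ≤ (𝒱.weightFiltration W (q + r)).comap
      (((LinearMap.toSpanSingleton 𝒱.CurrentAlgebra M m).restrictScalars ℂ) ∘ₗ 𝒱.lieToCurrent) from
    h hx
  refine Submodule.span_le.2 ?_
  rintro _ ⟨Δ, v, f, hv, hΔ, rfl⟩
  obtain ⟨N, hN⟩ := hM.exists_lieF_smul_eq_zero m
  set s := Finset.Ico f.order (N + Δ - 1) with hs
  have htail : 𝒱.cur v (f - ∑ i ∈ s, f.coeff i • HahnSeries.single i (1 : ℂ)) ∈ 𝒱.lieF N := by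
    refine Submodule.subset_span ⟨Δ, v, _, hv, fun i hi => ?_, rfl⟩
    rw [HahnSeries.coeff_sub, HahnSeries.coeff_sum]
    simp only [HahnSeries.coeff_smul, HahnSeries.coeff_single, smul_eq_mul, mul_ite, mul_one,
      mul_zero, Finset.sum_ite_eq, hs, Finset.mem_Ico, hi, and_true]
    split_ifs with h
    · simp
    · rw [HahnSeries.coeff_eq_zero_of_lt_order (not_le.1 h), sub_zero]
  have hf : 𝒱.lieToCurrent (𝒱.cur v f) • m =
      ∑ i ∈ s, f.coeff i • 𝒱.mode Δ (i - Δ + 1) v • m := by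
    have hsplit := 𝒱.cur_add_right v (f - ∑ i ∈ s, f.coeff i • HahnSeries.single i (1 : ℂ))
      (∑ i ∈ s, f.coeff i • HahnSeries.single i (1 : ℂ))
    rw [sub_add_cancel] at hsplit
    rw [hsplit, map_add, add_smul, hN _ htail, zero_add, cur_sum_right, map_sum, Finset.sum_smul]
    refine Finset.sum_congr rfl fun i _ => ?_
    rw [cur_smul_right, map_smul, smul_assoc, mode_eq_lieToCurrent,
      show i - Δ + 1 + Δ - 1 = i by ring]
  change 𝒱.lieToCurrent (𝒱.cur v f) • m ∈ 𝒱.weightFiltration W (q + r)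
  rw [hf]
  exact Submodule.sum_mem _ fun i _ => Submodule.smul_mem _ _ (mode_smul_mem hv _ (by omega) hm)

lemma IsVModule.envG_smul_mem (hM : 𝒱.IsVModule M) {p : ℤ} {a : 𝒱.Env} (ha : a ∈ 𝒱.envG p)
    {w : M} (hw : w ∈ W) : 𝒱.toCurrent (𝒱.toUHat a) • w ∈ 𝒱.weightFiltration W p := by
  suffices h : 𝒱.envG p ≤ (𝒱.weightFiltration W p).comap
      (((LinearMap.toSpanSingleton 𝒱.CurrentAlgebra M w).restrictScalars ℂ) ∘ₗ
        𝒱.toCurrent.toLinearMap ∘ₗ 𝒱.toUHat.toLinearMap) from h ha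
  refine Submodule.span_le.2 ?_
  rintro _ ⟨l, hl, hs, rfl⟩
  change 𝒱.toCurrent (𝒱.toUHat _) • w ∈ 𝒱.weightFiltration W p
  refine weightFiltration_mono hs ?_
  clear hs
  induction l with
  | nil => simpa using mem_weightFiltration_of_mem le_rfl hw
  | cons a l ih =>
    simp only [List.map_cons, List.prod_cons, List.sum_cons, map_mul, mul_smul]
    rw [add_comm]
    exact hM.lieToCurrent_smul_mem (hl a (by simp)) (ih fun b hb => hl b (by simp [hb]))

lemma modeProd_mem_curG {l : List (ℤ × ℤ × V)} (hl : ∀ a ∈ l, a.2.2 ∈ 𝒱.wt a.1) {p : ℤ}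
    (hp : (l.map Prod.fst).sum ≤ p) : 𝒱.modeProd l ∈ 𝒱.curG p := by
  let x (a : ℤ × ℤ × V) := 𝒱.cur a.2.2 (HahnSeries.single (a.2.1 + a.1 - 1) (1 : ℂ))
  let e := (l.map fun a => 𝒱.envι (x a)).prod
  have he : 𝒱.toCurrent (𝒱.toUHat e) = 𝒱.modeProd l := by
    simp only [e, map_list_prod, List.map_map]
    rfl
  have hG : e ∈ 𝒱.envG p := by
    refine Submodule.subset_span ⟨l.map fun a => (a.1, x a), ?_, ?_, ?_⟩
    · simp only [List.mem_map]
      rintro _ ⟨a, ha, rfl⟩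
      exact 𝒱.single_mem_lieG (hl a ha) _
    · simpa [Function.comp_def] using hp
    · simp [e, Function.comp_def]
  obtain ⟨q, hq⟩ := 𝒱.exists_mem_envF e
  rw [← he]
  exact ⟨_, 𝒱.mem_complG_iff.2 ⟨q, Submodule.le_topologicalClosure _ ⟨e, ⟨hG, hq⟩, rfl⟩⟩, rfl⟩

/-- The elements of `G_p 𝒰(V)`, limits of elements of `G_p U(𝔤(V))`, act on each vector as finite
linear combinations of monomials in the modes. -/
lemma IsVModule.goodFiltration_eq (hM : 𝒱.IsVModule M) (W : Submodule ℂ M) (p : ℤ) :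
    𝒱.goodFiltration W p = 𝒱.weightFiltration W p := by
  unfold goodFiltration
  split_ifs with hp
  · exact (weightFiltration_of_neg hp).symm
  refine le_antisymm (Submodule.span_le.2 ?_) (Submodule.span_le.2 ?_)
  · rintro _ ⟨_, ⟨z, hz, rfl⟩, w, hw, rfl⟩
    obtain ⟨q, hz⟩ := 𝒱.mem_complG_iff.1 hz
    obtain ⟨N, hN⟩ := hM.continuous w q
    obtain ⟨a, ha, haz⟩ := 𝒱.exists_sub_mem_complFN inf_le_right hz N
    change 𝒱.toCurrent z • w ∈ 𝒱.weightFiltration W p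
    rw [𝒱.smul_eq_smul_of_sub_mem (t := 𝒱.toUHat a) hN haz]
    exact hM.envG_smul_mem ha.1 hw
  · rintro _ ⟨l, hl, hs, w, hw, rfl⟩
    exact Submodule.subset_span ⟨_, modeProd_mem_curG hl hs, w, hw, rfl⟩

end

section

variable {V : Type u} [AddCommGroup V] [Module ℂ V] {𝒱 : ChiralVOA V}

/-! ### Homogeneous components modulo `C₂(V)` -/

variable (𝒱) in
/-- The part of `C₂(V)` of weight `Δ`, given by its homogeneous generators. -/
def C2wt (Δ : ℤ) : Submodule ℂ V :=
  Submodule.span ℂ {x | ∃ (Δ₁ Δ₂ k : ℤ) (v₁ v₂ : V), v₁ ∈ 𝒱.wt Δ₁ ∧ v₂ ∈ 𝒱.wt Δ₂ ∧ 1 ≤ k ∧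
    Δ = Δ₁ + Δ₂ + k ∧ x = 𝒱.J (-Δ₁ - k) v₁ v₂}

variable (𝒱) in
/-- The projection of `V` to `V_Δ`. -/
def proj (Δ : ℤ) : V →ₗ[ℂ] V :=
  (𝒱.wt Δ).subtype ∘ₗ DirectSum.component ℂ ℤ (fun i => 𝒱.wt i) Δ ∘ₗ
    (LinearEquiv.ofBijective (DirectSum.coeLinearMap 𝒱.wt) 𝒱.decomposition).symm.toLinearMap

lemma proj_of_mem {Δ : ℤ} {v : V} (hv : v ∈ 𝒱.wt Δ) : 𝒱.proj Δ v = v :=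
  congrArg Subtype.val (𝒱.decomposition.ofBijective_coeLinearMap_of_mem hv)

lemma proj_of_mem_ne {Δ Δ' : ℤ} (h : Δ' ≠ Δ) {v : V} (hv : v ∈ 𝒱.wt Δ') : 𝒱.proj Δ v = 0 :=
  congrArg Subtype.val (𝒱.decomposition.ofBijective_coeLinearMap_of_mem_ne h hv)

lemma proj_mem_of_graded {U : Submodule ℂ V} (hU : U = ⨆ Δ : ℤ, U ⊓ 𝒱.wt Δ) {u : V} (hu : u ∈ U)
    (Δ : ℤ) : 𝒱.proj Δ u ∈ U ⊓ 𝒱.wt Δ := by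
  suffices h : U ≤ (U ⊓ 𝒱.wt Δ).comap (𝒱.proj Δ) from h hu
  conv_lhs => rw [hU]
  refine iSup_le fun Δ' u hu => ?_
  rw [Submodule.mem_comap]
  rcases eq_or_ne Δ' Δ with rfl | h
  · rwa [proj_of_mem hu.2]
  · rw [proj_of_mem_ne h hu.2]; exact zero_mem _

lemma proj_mem_C2wt {c : V} (hc : c ∈ 𝒱.C2) (Δ : ℤ) : 𝒱.proj Δ c ∈ 𝒱.C2wt Δ := by
  suffices h : 𝒱.C2 ≤ (𝒱.C2wt Δ).comap (𝒱.proj Δ) from h hc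
  refine Submodule.span_le.2 ?_
  rintro _ ⟨Δ₁, k, v, u, hv, hk, rfl⟩
  have hu : u ∈ ⨆ Δ, 𝒱.wt Δ := by
    rw [𝒱.decomposition.submodule_iSup_eq_top]; trivial
  suffices h : (⨆ Δ, 𝒱.wt Δ) ≤ (𝒱.C2wt Δ).comap (𝒱.proj Δ ∘ₗ 𝒱.J (-Δ₁ - k) v) from h hu
  refine iSup_le fun Δ₂ u hu => ?_
  change 𝒱.proj Δ (𝒱.J (-Δ₁ - k) v u) ∈ 𝒱.C2wt Δ
  have hJ := 𝒱.J_mem (-Δ₁ - k) v Δ₂ u hu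
  rcases eq_or_ne (Δ₂ - (-Δ₁ - k)) Δ with rfl | h
  · rw [proj_of_mem hJ]
    exact Submodule.subset_span ⟨Δ₁, Δ₂, k, v, u, hv, hu, hk, by ring, rfl⟩
  · rw [proj_of_mem_ne h hJ]; exact zero_mem _

lemma exists_add_C2wt {U : Submodule ℂ V} (hUgraded : U = ⨆ Δ : ℤ, U ⊓ 𝒱.wt Δ)
    (hU : DirectSum.IsInternal ![U, 𝒱.C2, Submodule.span ℂ {𝒱.vac}]) {Δ : ℤ} (hΔ : Δ ≠ 0)
    {v : V} (hv : v ∈ 𝒱.wt Δ) : ∃ u ∈ U ⊓ 𝒱.wt Δ, ∃ c ∈ 𝒱.C2wt Δ, v = u + c := by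
  have htop : v ∈ ⨆ i, (![U, 𝒱.C2, Submodule.span ℂ {𝒱.vac}] : Fin 3 → Submodule ℂ V) i := by
    rw [hU.submodule_iSup_eq_top]; trivial
  have hle : (⨆ i, (![U, 𝒱.C2, Submodule.span ℂ {𝒱.vac}] : Fin 3 → Submodule ℂ V) i) ≤
      (U ⊔ 𝒱.C2) ⊔ Submodule.span ℂ {𝒱.vac} := by
    refine iSup_le fun i => ?_
    fin_cases i
    · exact le_sup_left.trans le_sup_left
    · exact le_sup_right.trans le_sup_left
    · exact le_sup_right
  obtain ⟨y, hy, z, hz, rfl⟩ := Submodule.mem_sup.1 (hle htop)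
  obtain ⟨u, hu, c, hc, rfl⟩ := Submodule.mem_sup.1 hy
  obtain ⟨a, rfl⟩ := Submodule.mem_span_singleton.1 hz
  refine ⟨_, proj_mem_of_graded hUgraded hu Δ, _, proj_mem_C2wt hc Δ, ?_⟩
  conv_lhs => rw [← proj_of_mem hv]
  rw [map_add, map_add, map_smul, proj_of_mem_ne hΔ.symm 𝒱.vac_mem, smul_zero, add_zero]

lemma exists_eq_smul_vac {v : V} (hv : v ∈ 𝒱.wt 0) : ∃ a : ℂ, v = a • 𝒱.vac := by
  obtain ⟨a, ha⟩ := exists_smul_eq_of_finrank_eq_one 𝒱.finrank_wt_zero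
    (x := (⟨𝒱.vac, 𝒱.vac_mem⟩ : 𝒱.wt 0)) (by simpa using 𝒱.vac_ne_zero) ⟨v, hv⟩
  exact ⟨a, (congrArg Subtype.val ha).symm⟩

/-! ### Relations in the associated graded module -/

variable {M : Type v} [AddCommGroup M] [Module ℂ M] [Module 𝒱.CurrentAlgebra M]
  [IsScalarTower ℂ 𝒱.CurrentAlgebra M] {W : Submodule ℂ M}

/-- Modes commute in the associated graded module: every term of the commutator formula has weight
less than `Δ₁ + Δ₂`. -/
lemma commutator_smul_mem {Δ₁ Δ₂ : ℤ} {v₁ v₂ : V} (h₁ : v₁ ∈ 𝒱.wt Δ₁) (h₂ : v₂ ∈ 𝒱.wt Δ₂)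
    (m n : ℤ) {q : ℤ} {x : M} (hx : x ∈ 𝒱.weightFiltration W q) :
    𝒱.mode Δ₁ m v₁ • 𝒱.mode Δ₂ n v₂ • x - 𝒱.mode Δ₂ n v₂ • 𝒱.mode Δ₁ m v₁ • x ∈
      𝒱.weightFiltration W (q + Δ₁ + Δ₂ - 1) := by
  rw [smul_smul, smul_smul, 𝒱.mode_mul_mode h₁ h₂, add_smul, add_sub_cancel_left, Finset.sum_smul]
  refine Submodule.sum_mem _ fun j _ => ?_
  rw [smul_assoc]
  exact Submodule.smul_mem _ _ (mode_smul_mem (𝒱.J_mem _ _ _ _ h₂) _ (by omega) hx)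

/-- The modes `J_n(v)` with `n ≥ 0` and `v` of positive weight act by zero on the associated graded
module: they can be commuted to the right, where they preserve `W`. -/
lemma IsGoodGenerator.mode_smul_mem_of_nonneg (hW : 𝒱.IsGoodGenerator W) {Δ : ℤ} (hΔ : 1 ≤ Δ)
    {v : V} (hv : v ∈ 𝒱.wt Δ) {n : ℤ} (hn : 0 ≤ n) {q : ℤ} {x : M}
    (hx : x ∈ 𝒱.weightFiltration W q) :
    𝒱.mode Δ n v • x ∈ 𝒱.weightFiltration W (q + Δ - 1) := by
  refine smul_mem_of_mem_span _ ?_ hx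
  rintro _ ⟨l, hl, hs, w, hw, rfl⟩
  refine weightFiltration_mono (p := (l.map Prod.fst).sum + Δ - 1) (by omega) ?_
  clear hs
  induction l with
  | nil =>
    simp only [modeProd_nil, one_smul, List.map_nil, List.sum_nil]
    exact mem_weightFiltration_of_mem (by omega) (hW.mode_smul_mem hn hv hw)
  | cons a l ih =>
    have hl' : ∀ b ∈ l, b.2.2 ∈ 𝒱.wt b.1 := fun b hb => hl b (by simp [hb])
    have ha := hl a (by simp)
    rw [modeProd_cons, mul_smul, List.map_cons, List.sum_cons]
    have h1 := commutator_smul_mem hv ha n a.2.1 (modeProd_smul_mem hl' hw)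
    have h2 := ChiralVOA.mode_smul_mem ha a.2.1 le_rfl (ih hl')
    have h3 := add_mem (weightFiltration_mono (q := a.1 + (l.map Prod.fst).sum + Δ - 1)
      (by omega) h1) (weightFiltration_mono (by omega) h2)
    rwa [sub_add_cancel] at h3

/-- The modes of vectors in `C₂(V)` act by zero on the associated graded module: by associativity
they are quadratic expressions in modes of smaller total weight. -/
lemma IsVModule.mode_C2wt_smul_mem (hM : 𝒱.IsVModule M) {Δ : ℤ} {c : V} (hc : c ∈ 𝒱.C2wt Δ)
    (m : ℤ) {q : ℤ} {x : M} (hx : x ∈ 𝒱.weightFiltration W q) :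
    𝒱.mode Δ m c • x ∈ 𝒱.weightFiltration W (q + Δ - 1) := by
  induction hc using Submodule.span_induction with
  | zero => rw [mode_zero, zero_smul]; exact zero_mem _
  | add a b _ _ ha hb => rw [mode_add, add_smul]; exact add_mem ha hb
  | smul a b _ hb => rw [mode_smul, smul_assoc]; exact Submodule.smul_mem _ _ hb
  | mem c hc =>
    obtain ⟨Δ₁, Δ₂, k, v₁, v₂, h₁, h₂, hk, rfl, rfl⟩ := hc
    obtain ⟨K, hK⟩ := hM.associativity h₁ h₂ m (-Δ₁ - k) x
    have h := hK K le_rfl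
    rw [show Δ₂ - (-Δ₁ - k) = Δ₁ + Δ₂ + k by ring] at h
    rw [h]
    refine Submodule.sum_mem _ fun j _ => Submodule.smul_mem _ _
      (sub_mem ?_ (Submodule.smul_mem _ _ ?_))
    · exact mode_smul_mem h₁ _ (by omega) (mode_smul_mem h₂ _ le_rfl hx)
    · exact mode_smul_mem h₂ _ (by omega) (mode_smul_mem h₁ _ le_rfl hx)

lemma choose_neg_one (j : ℕ) : Ring.choose (-1 : ℤ) j = (-1) ^ j := by
  induction j with
  | zero => simp
  | succ k ih =>
    have h := Ring.choose_succ_succ (-1 : ℤ) k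
    rw [neg_add_cancel, Ring.choose_zero_pos _ k.succ_pos, ih] at h
    rw [pow_succ]
    linarith

lemma sum_range_add_eq_sum_Ioc {A : Type*} [AddCommGroup A] (g : ℤ → A) (c : ℤ) (k : ℕ) :
    ∑ j ∈ Finset.range k, (g (c - j) + g (j + c + 1)) = ∑ a ∈ Finset.Ioc (c - k) (c + k), g a := by
  induction k with
  | zero => simp
  | succ k ih =>
    have h : Finset.Ioc (c - ((k + 1 : ℕ) : ℤ)) (c + ((k + 1 : ℕ) : ℤ)) =
        insert (c - k) (insert (k + c + 1 : ℤ) (Finset.Ioc (c - k) (c + k))) := by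
      ext a
      simp only [Finset.mem_Ioc, Finset.mem_insert]
      push_cast
      omega
    rw [Finset.sum_range_succ, ih, h, Finset.sum_insert, Finset.sum_insert]
    · abel
    · simp only [Finset.mem_Ioc]; omega
    · simp only [Finset.mem_Ioc, Finset.mem_insert]; omega

/-- In the associated graded module, the mode `J_m` of `J_{-Δ₁}(v₁)v₂` is the convolution of the
modes of `v₁` and `v₂`. Only the pairs of negative modes contribute. -/
lemma IsVModule.mode_normalProduct_smul_sub_mem (hM : 𝒱.IsVModule M) (hW : 𝒱.IsGoodGenerator W)
    {Δ₁ Δ₂ : ℤ} (hΔ₁ : 1 ≤ Δ₁) (hΔ₂ : 1 ≤ Δ₂) {v₁ v₂ : V} (h₁ : v₁ ∈ 𝒱.wt Δ₁) (h₂ : v₂ ∈ 𝒱.wt Δ₂)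
    (m : ℤ) {q : ℤ} {x : M} (hx : x ∈ 𝒱.weightFiltration W q) :
    𝒱.mode (Δ₁ + Δ₂) m (𝒱.J (-Δ₁) v₁ v₂) • x -
      ∑ a ∈ Finset.Ioo m 0, 𝒱.mode Δ₁ a v₁ • 𝒱.mode Δ₂ (m - a) v₂ • x ∈
        𝒱.weightFiltration W (q + Δ₁ + Δ₂ - 1) := by
  let g (a : ℤ) : M := 𝒱.mode Δ₁ a v₁ • 𝒱.mode Δ₂ (m - a) v₂ • x
  let h (a : ℤ) : M := 𝒱.mode Δ₂ (m - a) v₂ • 𝒱.mode Δ₁ a v₁ • x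
  have hcomm (a : ℤ) : h a - g a ∈ 𝒱.weightFiltration W (q + Δ₁ + Δ₂ - 1) := by
    have := neg_mem (commutator_smul_mem h₁ h₂ a (m - a) hx)
    rwa [neg_sub] at this
  -- the pairs with a nonnegative mode do not contribute
  have hg (a : ℤ) (ha : a ∉ Finset.Ioo m 0) :
      g a ∈ 𝒱.weightFiltration W (q + Δ₁ + Δ₂ - 1) := by
    rw [Finset.mem_Ioo, not_and_or, not_lt, not_lt] at ha
    rcases ha with ha | ha
    · exact mode_smul_mem h₁ a (by omega)
        (hW.mode_smul_mem_of_nonneg hΔ₂ h₂ (n := m - a) (by omega) hx)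
    · exact weightFiltration_mono (by omega) (hW.mode_smul_mem_of_nonneg hΔ₁ h₁ ha
        (mode_smul_mem h₂ (m - a) le_rfl hx))
  obtain ⟨K, hK⟩ := hM.associativity h₁ h₂ m (-Δ₁) x
  -- the range of summation of the truncated formula contains `Ioo m 0` for this `k`
  obtain ⟨k, hkK, hkm, hk0⟩ : ∃ k : ℕ, K ≤ k ∧ -Δ₁ - k ≤ m ∧ 0 ≤ -Δ₁ + k :=
    ⟨K + m.natAbs + Δ₁.natAbs, by omega, by omega, by omega⟩
  have hsum : 𝒱.mode (Δ₁ + Δ₂) m (𝒱.J (-Δ₁) v₁ v₂) • x =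
      ∑ j ∈ Finset.range k, (g (-Δ₁ - j) + h (j + -Δ₁ + 1)) := by
    rw [add_comm Δ₁, ← sub_neg_eq_add, hK k hkK]
    refine Finset.sum_congr rfl fun j _ => ?_
    have hsign : (-1 : ℂ) ^ j * ((Ring.choose (-Δ₁ + Δ₁ - 1) j : ℤ) : ℂ) = 1 := by
      rw [neg_add_cancel, zero_sub, choose_neg_one, Int.cast_pow, Int.cast_neg, Int.cast_one,
        ← mul_pow]
      simp
    rw [hsign, one_smul, neg_add_cancel, zero_sub, zpow_neg_one, inv_neg, inv_one, neg_one_smul,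
      sub_neg_eq_add]
    simp only [g, h]
    rw [show m - (-Δ₁ - j) = m - -Δ₁ + (j : ℤ) by ring,
      show m - ((j : ℤ) + -Δ₁ + 1) = m + Δ₁ - j - 1 by ring, ← sub_eq_add_neg]
  have hsplit : 𝒱.mode (Δ₁ + Δ₂) m (𝒱.J (-Δ₁) v₁ v₂) • x - ∑ a ∈ Finset.Ioo m 0, g a =
      ∑ j ∈ Finset.range k, (h (j + -Δ₁ + 1) - g (j + -Δ₁ + 1)) +
        ∑ a ∈ Finset.Ioc (-Δ₁ - k) (-Δ₁ + k) \ Finset.Ioo m 0, g a := by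
    have hsub : Finset.Ioo m 0 ⊆ Finset.Ioc (-Δ₁ - k) (-Δ₁ + k) := fun a ha => by
      rw [Finset.mem_Ioo] at ha
      rw [Finset.mem_Ioc]
      omega
    have hIoc := sum_range_add_eq_sum_Ioc g (-Δ₁) k
    rw [← Finset.sum_sdiff hsub] at hIoc
    rw [hsum, eq_sub_of_add_eq hIoc.symm]
    simp only [Finset.sum_add_distrib, Finset.sum_sub_distrib]
    abel
  refine hsplit ▸ ?_
  exact add_mem (Submodule.sum_mem _ fun j _ => hcomm _)
    (Submodule.sum_mem _ fun a ha => hg a (Finset.mem_sdiff.1 ha).2)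

/-- Reordering the modes does not change the class of a monomial in the associated graded
module. -/
lemma modeProd_smul_sub_mem_of_perm {l l' : List (ℤ × ℤ × V)} (hp : l.Perm l')
    (hl : ∀ a ∈ l, a.2.2 ∈ 𝒱.wt a.1) {q : ℤ} {x : M} (hx : x ∈ 𝒱.weightFiltration W q) :
    𝒱.modeProd l • x - 𝒱.modeProd l' • x ∈
      𝒱.weightFiltration W ((l.map Prod.fst).sum + q - 1) := by
  have hprod : ∀ l : List (ℤ × ℤ × V), (∀ a ∈ l, a.2.2 ∈ 𝒱.wt a.1) →
      𝒱.modeProd l • x ∈ 𝒱.weightFiltration W ((l.map Prod.fst).sum + q) := by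
    intro l hl
    induction l with
    | nil => simpa using hx
    | cons a l ih =>
      rw [modeProd_cons, mul_smul, List.map_cons, List.sum_cons]
      exact mode_smul_mem (hl a (by simp)) _ (by omega) (ih fun b hb => hl b (by simp [hb]))
  induction hp with
  | nil => simp
  | @cons a l₁ l₂ _ ih =>
    rw [modeProd_cons, modeProd_cons, mul_smul, mul_smul, ← smul_sub, List.map_cons, List.sum_cons]
    exact mode_smul_mem (hl a (by simp)) _ (by omega) (ih fun b hb => hl b (by simp [hb]))
  | swap a b l =>
    simp only [modeProd_cons, mul_smul, List.map_cons, List.sum_cons]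
    have h := commutator_smul_mem (hl b (by simp)) (hl a (by simp)) b.2.1 a.2.1
      (hprod l fun c hc => hl c (by simp [hc]))
    exact weightFiltration_mono (by omega) h
  | @trans l₁ l₂ l₃ h₁₂ h₂₃ ih₁ ih₂ =>
    have h := add_mem (ih₁ hl) ((h₁₂.map Prod.fst).sum_eq ▸
      ih₂ fun a ha => hl a (h₁₂.mem_iff.2 ha))
    rwa [sub_add_sub_cancel] at h

end

section

variable {V : Type u} [AddCommGroup V] [Module ℂ V] {𝒱 : ChiralVOA V}

/-! ### Straightening monomials -/

lemma exists_perm_cons_cons_of_not_nodup {α β : Type*} (f : α → β) (l : List α)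
    (h : ¬ (l.map f).Nodup) : ∃ a b l', l.Perm (a :: b :: l') ∧ f a = f b := by
  induction l with
  | nil => simp at h
  | cons c l ih =>
    by_cases hl : (l.map f).Nodup
    · have hc : f c ∈ l.map f := by
        by_contra hc
        exact h (by rw [List.map_cons, List.nodup_cons]; exact ⟨hc, hl⟩)
      obtain ⟨d, hd, hdc⟩ := List.mem_map.1 hc
      obtain ⟨s, t, rfl⟩ := List.append_of_mem hd
      exact ⟨c, d, s ++ t, List.Perm.cons _ List.perm_middle, hdc.symm⟩
    · obtain ⟨a, b, l', hp, hab⟩ := ih hl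
      refine ⟨a, b, c :: l', (hp.cons c).trans ?_, hab⟩
      exact (List.Perm.swap a c _).trans ((List.Perm.swap b c _).cons a)

lemma exists_perm_pairwise_lt {α : Type*} (f : α → ℤ) (l : List α) (h : (l.map f).Nodup) :
    ∃ l', l.Perm l' ∧ l'.Pairwise fun a b => f a < f b := by
  classical
  let r : α → α → Prop := fun a b => f a ≤ f b
  have : Std.Total r := ⟨fun a b => le_total (f a) (f b)⟩
  have : IsTrans α r := ⟨fun a b c => le_trans (a := f a) (b := f b) (c := f c)⟩
  have hp := List.perm_insertionSort r l
  refine ⟨_, hp.symm, ?_⟩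
  have hn : ((l.insertionSort r).map f).Nodup := (hp.map f).nodup_iff.2 h
  exact ((List.pairwise_insertionSort r l).and (List.pairwise_map.1 hn)).imp
    fun hab => lt_of_le_of_ne hab.1 hab.2

/-- A triple `(Δ, n, v)` that stands for a mode `J_n(v)` with `v ∈ U ∩ V_Δ`, `Δ > 0` and
`n < 0`. -/
structure IsCreation (𝒱 : ChiralVOA V) (U : Submodule ℂ V) (a : ℤ × ℤ × V) : Prop where
  mem : a.2.2 ∈ U
  mem_wt : a.2.2 ∈ 𝒱.wt a.1
  one_le : 1 ≤ a.1
  neg : a.2.1 < 0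

/-- For a list of triples `(Δ, n, v)`, the quantity `(∑ n)² - ∑ n²`. -/
def spread (l : List (ℤ × ℤ × V)) : ℤ :=
  (l.map fun a => a.2.1).sum ^ 2 - (l.map fun a => a.2.1 ^ 2).sum

lemma spread_nonneg {U : Submodule ℂ V} {l : List (ℤ × ℤ × V)} (hl : ∀ a ∈ l, 𝒱.IsCreation U a) :
    0 ≤ spread l := by
  suffices h : (l.map fun a => a.2.1).sum ≤ 0 ∧ 0 ≤ spread l from h.2
  induction l with
  | nil => simp [spread]
  | cons a l ih =>
    obtain ⟨h1, h2⟩ := ih fun b hb => hl b (by simp [hb])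
    have ha := (hl a (by simp)).neg
    simp only [spread, List.map_cons, List.sum_cons] at h1 h2 ⊢
    refine ⟨by omega, ?_⟩
    nlinarith [mul_nonneg_of_nonpos_of_nonpos ha.le h1]

variable {M : Type v} [AddCommGroup M] [Module ℂ M] [Module 𝒱.CurrentAlgebra M]

variable (𝒱) in
/-- The span of the vectors `J_{m₁}(v₁) ⋯ J_{m_r}(v_r) w` of total weight `p` with `w ∈ W`,
`vᵢ ∈ U` and `m₁ < ⋯ < m_r < 0`. -/
def strictSpan (U : Submodule ℂ V) (W : Submodule ℂ M) (p : ℤ) : Submodule ℂ M :=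
  Submodule.span ℂ {y | ∃ l : List (ℤ × ℤ × V), (∀ a ∈ l, 𝒱.IsCreation U a) ∧
    (l.Pairwise fun a b => a.2.1 < b.2.1) ∧ (l.map Prod.fst).sum = p ∧
    ∃ w ∈ W, y = 𝒱.modeProd l • w}

variable (𝒱) in
/-- The span of the vectors `J_{m₁}(v₁) ⋯ J_{m_r}(v_r) w` of total weight `p` with `w ∈ W`,
`vᵢ ∈ U` and negative `mᵢ` in any order. -/
def creationSpan (U : Submodule ℂ V) (W : Submodule ℂ M) (p : ℤ) : Submodule ℂ M :=
  Submodule.span ℂ {y | ∃ l : List (ℤ × ℤ × V), (∀ a ∈ l, 𝒱.IsCreation U a) ∧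
    (l.map Prod.fst).sum = p ∧ ∃ w ∈ W, y = 𝒱.modeProd l • w}

variable [IsScalarTower ℂ 𝒱.CurrentAlgebra M] {U : Submodule ℂ V} {W : Submodule ℂ M}

/-- The straightening step. If two modes have the same index `n`, their product is rewritten by
the convolution formula for the index `2n`. The term with `J_{2n}` has fewer factors; in the other
terms `(n, n)` is replaced by `(a, 2n - a)` with `a ≠ n`, which lowers the spread. -/
lemma IsVModule.modeProd_smul_mem_strictSpan (hM : 𝒱.IsVModule M) (hW : 𝒱.IsGoodGenerator W)
    (hUgraded : U = ⨆ Δ : ℤ, U ⊓ 𝒱.wt Δ)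
    (hU : DirectSum.IsInternal ![U, 𝒱.C2, Submodule.span ℂ {𝒱.vac}])
    {l : List (ℤ × ℤ × V)} (hl : ∀ a ∈ l, 𝒱.IsCreation U a) {w : M} (hw : w ∈ W) :
    𝒱.modeProd l • w ∈ 𝒱.strictSpan U W (l.map Prod.fst).sum ⊔
      𝒱.weightFiltration W ((l.map Prod.fst).sum - 1) := by
  induction hr : l.length using Nat.strong_induction_on generalizing l with
  | h r ihr =>
  induction hk : (spread l).toNat using Nat.strong_induction_on generalizing l with
  | h k ihk =>
  have hw0 : w ∈ 𝒱.weightFiltration W 0 := mem_weightFiltration_of_mem le_rfl hw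
  have hperm {l' : List (ℤ × ℤ × V)} (hp : l.Perm l') : 𝒱.modeProd l • w - 𝒱.modeProd l' • w ∈
      𝒱.weightFiltration W ((l.map Prod.fst).sum - 1) := by
    have h := modeProd_smul_sub_mem_of_perm hp (fun a ha => (hl a ha).mem_wt) hw0
    rwa [add_zero] at h
  by_cases hn : (l.map fun a => a.2.1).Nodup
  · obtain ⟨l', hp, hs⟩ := exists_perm_pairwise_lt _ l hn
    rw [← sub_add_cancel (𝒱.modeProd l • w) (𝒱.modeProd l' • w)]
    refine add_mem (Submodule.mem_sup_right (hperm hp)) (Submodule.mem_sup_left ?_)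
    exact Submodule.subset_span ⟨l', fun a ha => hl a (hp.mem_iff.2 ha), hs,
      (hp.map Prod.fst).sum_eq.symm, w, hw, rfl⟩
  · obtain ⟨⟨Δ₁, n, v₁⟩, ⟨Δ₂, n', v₂⟩, l', hp, hnn⟩ := exists_perm_cons_cons_of_not_nodup _ l hn
    obtain rfl : n = n' := hnn
    have h₁ : 𝒱.IsCreation U (Δ₁, n, v₁) := hl _ (hp.mem_iff.2 (by simp))
    have h₂ : 𝒱.IsCreation U (Δ₂, n, v₂) := hl _ (hp.mem_iff.2 (by simp))
    have hl' : ∀ a ∈ l', 𝒱.IsCreation U a := fun a ha => hl a (hp.mem_iff.2 (by simp [ha]))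
    have hlen : r = l'.length + 2 := by rw [← hr, hp.length_eq]; simp
    have hsum := (hp.map Prod.fst).sum_eq
    simp only [List.map_cons, List.sum_cons] at hsum
    have hΔ₁ : 1 ≤ Δ₁ := h₁.one_le
    have hΔ₂ : 1 ≤ Δ₂ := h₂.one_le
    have hn0 : n < 0 := h₁.neg
    have hx := modeProd_smul_mem (fun a ha => (hl' a ha).mem_wt) hw
    rw [← sub_add_cancel (𝒱.modeProd l • w) (𝒱.modeProd ((Δ₁, n, v₁) :: (Δ₂, n, v₂) :: l') • w)]
    refine add_mem (Submodule.mem_sup_right (hperm hp)) ?_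
    simp only [modeProd_cons, mul_smul]
    -- the term with fewer factors
    have hprod : 𝒱.mode (Δ₁ + Δ₂) (2 * n) (𝒱.J (-Δ₁) v₁ v₂) • 𝒱.modeProd l' • w ∈
        𝒱.strictSpan U W (l.map Prod.fst).sum ⊔
          𝒱.weightFiltration W ((l.map Prod.fst).sum - 1) := by
      have hJ : 𝒱.J (-Δ₁) v₁ v₂ ∈ 𝒱.wt (Δ₁ + Δ₂) := by
        have := 𝒱.J_mem (-Δ₁) v₁ Δ₂ v₂ h₂.mem_wt
        rwa [sub_neg_eq_add, add_comm] at this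
      obtain ⟨u, hu, c, hc, huc⟩ := exists_add_C2wt hUgraded hU (by omega) hJ
      rw [huc, mode_add, add_smul]
      refine add_mem ?_ (Submodule.mem_sup_right
        (weightFiltration_mono (by omega) (hM.mode_C2wt_smul_mem hc (2 * n) hx)))
      have h := ihr _ (by simp [hlen]) (l := (Δ₁ + Δ₂, 2 * n, u) :: l')
        (by
          rintro a (_ | ⟨_, ha⟩)
          · exact ⟨hu.1, hu.2, by change 1 ≤ Δ₁ + Δ₂; omega, by change 2 * n < 0; omega⟩
          · exact hl' a ha) rfl
      simpa only [modeProd_cons, mul_smul, List.map_cons, List.sum_cons, hsum, add_assoc] using h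
    -- the terms with smaller spread
    have hother (a : ℤ) (ha : a ∈ (Finset.Ioo (2 * n) 0).erase n) :
        𝒱.mode Δ₁ a v₁ • 𝒱.mode Δ₂ (2 * n - a) v₂ • 𝒱.modeProd l' • w ∈
          𝒱.strictSpan U W (l.map Prod.fst).sum ⊔
            𝒱.weightFiltration W ((l.map Prod.fst).sum - 1) := by
      rw [Finset.mem_erase, Finset.mem_Ioo] at ha
      have hcr : ∀ b ∈ (Δ₁, a, v₁) :: (Δ₂, 2 * n - a, v₂) :: l', 𝒱.IsCreation U b := by
        rintro b (_ | ⟨_, _ | ⟨_, hb⟩⟩)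
        · exact ⟨h₁.mem, h₁.mem_wt, h₁.one_le, ha.2.2⟩
        · exact ⟨h₂.mem, h₂.mem_wt, h₂.one_le, by change 2 * n - a < 0; omega⟩
        · exact hl' b hb
      have hlt : spread ((Δ₁, a, v₁) :: (Δ₂, 2 * n - a, v₂) :: l') < spread l := by
        have e1 := (hp.map fun a => a.2.1).sum_eq
        have e2 := (hp.map fun a => a.2.1 ^ 2).sum_eq
        simp only [List.map_cons, List.sum_cons] at e1 e2
        simp only [spread, List.map_cons, List.sum_cons, e1, e2]
        have : 0 < (a - n) ^ 2 := by
          have := sub_ne_zero.2 ha.1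
          positivity
        linear_combination (2 : ℤ) * this
      have h := ihk _ (by have := spread_nonneg hcr; omega) hcr (by simp [hlen]) rfl
      simpa only [modeProd_cons, mul_smul, List.map_cons, List.sum_cons, hsum] using h
    have hrel := hM.mode_normalProduct_smul_sub_mem hW hΔ₁ hΔ₂ h₁.mem_wt h₂.mem_wt (2 * n) hx
    have hmem : n ∈ Finset.Ioo (2 * n) 0 := by rw [Finset.mem_Ioo]; omega
    rw [← Finset.add_sum_erase _ _ hmem, show 2 * n - n = n by ring] at hrel
    have h := sub_mem (sub_mem hprod (Submodule.sum_mem _ hother)) (Submodule.mem_sup_right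
      (weightFiltration_mono (q := (l.map Prod.fst).sum - 1) (by omega) hrel))
    convert h using 1
    abel

/-- Modulo lower terms, every monomial is a combination of monomials in the negative modes of
vectors of `U`. -/
lemma IsVModule.modeProd_smul_mem_creationSpan (hM : 𝒱.IsVModule M) (hW : 𝒱.IsGoodGenerator W)
    (hUgraded : U = ⨆ Δ : ℤ, U ⊓ 𝒱.wt Δ)
    (hU : DirectSum.IsInternal ![U, 𝒱.C2, Submodule.span ℂ {𝒱.vac}])
    {l : List (ℤ × ℤ × V)} (hl : ∀ a ∈ l, a.2.2 ∈ 𝒱.wt a.1) {w : M} (hw : w ∈ W) :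
    𝒱.modeProd l • w ∈ 𝒱.creationSpan U W (l.map Prod.fst).sum ⊔
      𝒱.weightFiltration W ((l.map Prod.fst).sum - 1) := by
  induction l with
  | nil =>
    exact Submodule.mem_sup_left (Submodule.subset_span ⟨[], by simp, rfl, w, hw, rfl⟩)
  | cons a l ih =>
    obtain ⟨Δ, n, v⟩ := a
    have hv : v ∈ 𝒱.wt Δ := hl (Δ, n, v) (by simp)
    simp only [modeProd_cons, mul_smul, List.map_cons, List.sum_cons]
    obtain ⟨y, hy, z, hz, hyz⟩ := Submodule.mem_sup.1 (ih fun b hb => hl b (by simp [hb]))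
    rw [← hyz, smul_add]
    refine add_mem ?_ (Submodule.mem_sup_right (mode_smul_mem hv n (by omega) hz))
    rcases lt_trichotomy Δ 0 with hΔ | rfl | hΔ
    · rw [eq_zero_of_mem_wt_neg hΔ hv, mode_zero, zero_smul]
      exact zero_mem _
    · obtain ⟨c, rfl⟩ := exists_eq_smul_vac hv
      rw [mode_smul, zero_add]
      rcases eq_or_ne n 0 with rfl | hn
      · rw [mode_zero_vac, smul_assoc, one_smul]
        exact Submodule.smul_mem _ _ (Submodule.mem_sup_left hy)
      · rw [mode_vac _ hn, smul_zero, zero_smul]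
        exact zero_mem _
    · refine smul_mem_of_mem_span _ ?_ hy
      rintro _ ⟨k, hk, hs, w', hw', rfl⟩
      have hx := modeProd_smul_mem (fun a ha => (hk a ha).mem_wt) hw'
      rw [hs] at hx
      rcases le_or_gt 0 n with hn | hn
      · exact Submodule.mem_sup_right (weightFiltration_mono (by omega)
          (hW.mode_smul_mem_of_nonneg hΔ hv hn hx))
      · obtain ⟨u, hu, c, hc, rfl⟩ := exists_add_C2wt hUgraded hU hΔ.ne' hv
        rw [mode_add, add_smul]
        refine add_mem (Submodule.mem_sup_left ?_) (Submodule.mem_sup_right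
          (weightFiltration_mono (by omega) (hM.mode_C2wt_smul_mem hc n hx)))
        refine Submodule.subset_span ⟨(Δ, n, u) :: k, ?_, by simp [hs], w', hw', ?_⟩
        · rintro a (_ | ⟨_, ha⟩)
          · exact ⟨hu.1, hu.2, hΔ, hn⟩
          · exact hk a ha
        · rw [modeProd_cons, mul_smul]

lemma IsVModule.weightFiltration_le (hM : 𝒱.IsVModule M) (hW : 𝒱.IsGoodGenerator W)
    (hUgraded : U = ⨆ Δ : ℤ, U ⊓ 𝒱.wt Δ)
    (hU : DirectSum.IsInternal ![U, 𝒱.C2, Submodule.span ℂ {𝒱.vac}]) (p : ℤ) :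
    𝒱.weightFiltration W p ≤ 𝒱.strictSpan U W p ⊔ 𝒱.weightFiltration W (p - 1) := by
  refine Submodule.span_le.2 ?_
  rintro _ ⟨l, hl, hs, w, hw, rfl⟩
  rcases hs.lt_or_eq with hs | rfl
  · exact Submodule.mem_sup_right
      (weightFiltration_mono (by omega) (modeProd_smul_mem hl hw))
  · refine (sup_le ?_ le_sup_right :
      𝒱.creationSpan U W (l.map Prod.fst).sum ⊔ 𝒱.weightFiltration W ((l.map Prod.fst).sum - 1) ≤ _)
      (hM.modeProd_smul_mem_creationSpan hW hUgraded hU hl hw)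
    refine Submodule.span_le.2 ?_
    rintro _ ⟨k, hk, hs, w', hw', rfl⟩
    rw [← hs]
    exact hM.modeProd_smul_mem_strictSpan hW hUgraded hU hk hw'

/-- A set of classes in `gr_p M` that contains those of the strictly ordered monomials of weight `p`
spans. -/
lemma IsVModule.span_gr_eq_top (hM : 𝒱.IsVModule M) (hW : 𝒱.IsGoodGenerator W)
    (hUgraded : U = ⨆ Δ : ℤ, U ⊓ 𝒱.wt Δ)
    (hU : DirectSum.IsInternal ![U, 𝒱.C2, Submodule.span ℂ {𝒱.vac}]) {p : ℤ} {X : Set (𝒱.gr W p)}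
    (hX : ∀ l : List (ℤ × ℤ × V), (∀ a ∈ l, 𝒱.IsCreation U a) →
      (l.Pairwise fun a b => a.2.1 < b.2.1) → (l.map Prod.fst).sum = p →
      ∀ w ∈ W, ∀ y : 𝒱.goodFiltration W p, (y : M) = 𝒱.modeProd l • w →
        Submodule.Quotient.mk y ∈ X) : Submodule.span ℂ X = ⊤ := by
  let Q := (𝒱.goodFiltration W (p - 1)).submoduleOf (𝒱.goodFiltration W p)
  have hstrict : 𝒱.strictSpan U W p ≤
      ((Submodule.span ℂ X).comap Q.mkQ).map (𝒱.goodFiltration W p).subtype := by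
    refine Submodule.span_le.2 ?_
    rintro _ ⟨l, hl, hs, hsum, w, hw, rfl⟩
    have hy : 𝒱.modeProd l • w ∈ 𝒱.goodFiltration W p := by
      rw [hM.goodFiltration_eq, ← hsum]
      exact modeProd_smul_mem (fun a ha => (hl a ha).mem_wt) hw
    exact ⟨⟨_, hy⟩, Submodule.subset_span (hX l hl hs hsum w hw ⟨_, hy⟩ rfl), rfl⟩
  refine eq_top_iff.2 fun x _ => ?_
  obtain ⟨⟨y, hy⟩, rfl⟩ := Submodule.Quotient.mk_surjective _ x
  have hy' := hy
  rw [hM.goodFiltration_eq] at hy'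
  obtain ⟨s, hs, t, ht, rfl⟩ := Submodule.mem_sup.1
    (hM.weightFiltration_le hW hUgraded hU p hy')
  obtain ⟨⟨s, hsp⟩, hsX, rfl⟩ := hstrict hs
  have heq : (Submodule.Quotient.mk ⟨_, hy⟩ : 𝒱.gr W p) = Submodule.Quotient.mk ⟨s, hsp⟩ := by
    refine (Submodule.Quotient.eq _).2 ?_
    change s + t - s ∈ 𝒱.goodFiltration W (p - 1)
    rwa [add_sub_cancel_left, hM.goodFiltration_eq]
  rw [heq]
  exact hsX

end

end ChiralVOA
end

theorem mainTheorem8 {V : Type*} [AddCommGroup V] [Module ℂ V] (𝒱 : ChiralVOA V)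
    {M : Type*} [AddCommGroup M] [Module ℂ M] [Module 𝒱.CurrentAlgebra M]
    [IsScalarTower ℂ 𝒱.CurrentAlgebra M] (hM : 𝒱.IsVModule M)
    (W : Submodule ℂ M) (hW : 𝒱.IsGoodGenerator W)
    (U : Submodule ℂ V) (hUgraded : U = ⨆ Δ : ℤ, U ⊓ 𝒱.wt Δ)
    (hU : DirectSum.IsInternal ![U, 𝒱.C2, Submodule.span ℂ {𝒱.vac}]) (p : ℕ) :
    Submodule.span ℂ {x : 𝒱.gr W p | ∃ (r : ℕ) (n : Fin r → ℤ) (Δ : Fin r → ℤ) (v : Fin r → V)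
        (w : M) (y : 𝒱.goodFiltration W p),
        StrictAnti n ∧ (∀ i, 0 < n i) ∧ (∀ i, v i ∈ U ∧ v i ∈ 𝒱.wt (Δ i)) ∧ ∑ i, Δ i = p ∧
        w ∈ W ∧ (y : M) = (List.ofFn fun i => 𝒱.mode (Δ i) (-n i) (v i)).prod • w ∧
        x = Submodule.Quotient.mk y} = ⊤ := by
  refine hM.span_gr_eq_top hW hUgraded hU fun l hl hs hsum w hw y hy => ?_
  refine ⟨l.length, fun i => -(l.get i).2.1, fun i => (l.get i).1, fun i => (l.get i).2.2, w, y,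
    fun i j hij => neg_lt_neg (List.pairwise_iff_get.1 hs i j hij),
    fun i => neg_pos.2 (hl _ (l.get_mem i)).neg,
    fun i => ⟨(hl _ (l.get_mem i)).mem, (hl _ (l.get_mem i)).mem_wt⟩, ?_, hw, ?_, rfl⟩
  · conv_rhs => rw [← hsum, ← List.ofFn_get l, List.map_ofFn, List.sum_ofFn]
    rfl
  · conv_lhs => rw [hy, ChiralVOA.modeProd, ← List.ofFn_get l, List.map_ofFn]
    simp only [neg_neg]
    rfl
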